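/- For every $K>0$ there are constants $C_1>0$ and $c>0$, depending only on $K$, such that the following holds. Let $m,n_1,n_2,k,\ell$ be nonnegative integers with $\ell\le m$, let $\delta_k\in(0,1]$, let $V^*\in\mathbb R^{m\times m}$ be a (real) unitary matrix, and let $P_\ell:\mathbb R^m\to\mathbb R^\ell$ be the projection onto the first $\ell$ coordinates. Let $\mathcal M:\mathbb R^{n_1\times n_2}\to\mathbb R^m$ be a random linear map which is mean-zero, unit-variance sub-Gaussian with parameter $K$; that is, the entries of the $m\times n_1n_2$ matrix $A_{\mathcal M}$ determined by $\mathcal M(X)=A_{\mathcal M}\vec X$ (where $\vec X$ stacks the columns of $X$) are independent and identically distributed copies of a real random variable $\xi$ with $\mathbb E\xi=0$, $\operatorname{Var}\xi=1$ and $\mathbb P[|\xi|>t]\le \exp(1-t^2/K)$ for all $t\ge 0$. If $$\ell\ \ge\ C_1\,\frac{k(n_1+n_2+1)}{\delta_k^2},$$ then with probability exceeding $1-2e^{-C_2\ell}$, where $C_2=c\,\delta_k^2$, the operator $\frac1{\sqrt\ell}P_\ell V^*\mathcal M$ has the matrix-RIP of order $k$ with constant $\delta_k$, i.e. for all $X\in\mathbb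 R^{n_1\times n_2}$ of rank at most $k$ simultaneously, $$(1-\delta_k)\|X\|_F^2\ \le\ \Big\|\tfrac1{\sqrt\ell}P_\ell V^*\mathcal M(X)\Big\|_2^2\ \le\ (1+\delta_k)\|X\|_F^2 .$$ -/

import Mathlib

open MeasureTheory ProbabilityTheory

noncomputable section

/-- The matrix `A_M` of a linear map `M : ℝ^{n₁ × n₂} → ℝ^m`. Its columns are indexed as the
entries of the column-stacked vector `Matrix.vec X`, by pairs (column of `X`, row of `X`). -/
def operatorMatrix {m n₁ n₂ : ℕ}
    (M : Matrix (Fin n₁) (Fin n₂) ℝ →ₗ[ℝ] EuclideanSpace ℝ (Fin m)) :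
    Matrix (Fin m) (Fin n₂ × Fin n₁) ℝ :=
  Matrix.of fun i p => M (Matrix.single p.2 p.1 1) i

/-- The defining property of `A_M`: `M X = A_M (vec X)` for all `X`. -/
theorem operatorMatrix_mulVec_vec {m n₁ n₂ : ℕ}
    (M : Matrix (Fin n₁) (Fin n₂) ℝ →ₗ[ℝ] EuclideanSpace ℝ (Fin m))
    (X : Matrix (Fin n₁) (Fin n₂) ℝ) :
    M X = WithLp.toLp 2 (Matrix.mulVec (operatorMatrix M) (Matrix.vec X)) := by
  ext i
  conv_lhs => rw [Matrix.matrix_eq_sum_single X]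
  simp only [map_sum, operatorMatrix, Matrix.mulVec, dotProduct, Matrix.of_apply, Matrix.vec,
    Fintype.sum_prod_type]
  rw [Finset.sum_comm]
  simp only [WithLp.ofLp_sum, Finset.sum_apply]
  refine Finset.sum_congr rfl fun j _ => Finset.sum_congr rfl fun a _ => ?_
  have h : Matrix.single a j (X a j) = X a j • Matrix.single a j (1 : ℝ) := by
    simp [Matrix.smul_single]
  rw [h, map_smul]
  simp [mul_comm]

/-- A real random variable `X` is sub-Gaussian with parameter `K` (`K > 0`). -/
def IsSubGaussian {Ω : Type*} [MeasurableSpace Ω] (X : Ω → ℝ) (K : ℝ) (P : Measure Ω) : Prop :=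
  ∀ t : ℝ, 0 ≤ t → P.real {ω | t < |X ω|} ≤ Real.exp (1 - t ^ 2 / K)

/-- A random linear map `M : ℝ^{n₁ × n₂} → ℝ^m` is a mean-zero, unit-variance sub-Gaussian linear
map with parameter `K` if the entries of its matrix are independent and identically distributed
with a sub-Gaussian distribution of parameter `K`, mean zero and variance one. -/
structure IsSubGaussianMap {Ω : Type*} [MeasurableSpace Ω] {m n₁ n₂ : ℕ}
    (M : Ω → Matrix (Fin n₁) (Fin n₂) ℝ →ₗ[ℝ] EuclideanSpace ℝ (Fin m))
    (K : ℝ) (P : Measure Ω) : Prop where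
  measurable : ∀ i p, Measurable fun ω => operatorMatrix (M ω) i p
  indep : iIndepFun (fun (q : Fin m × (Fin n₂ × Fin n₁)) ω => operatorMatrix (M ω) q.1 q.2) P
  identDistrib : ∀ i p j q, IdentDistrib (fun ω => operatorMatrix (M ω) i p)
    (fun ω => operatorMatrix (M ω) j q) P P
  subGaussian : ∀ i p, IsSubGaussian (fun ω => operatorMatrix (M ω) i p) K P
  mean_zero : ∀ i p, ∫ ω, operatorMatrix (M ω) i p ∂P = 0
  unit_variance : ∀ i p, variance (fun ω => operatorMatrix (M ω) i p) P = 1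

/-- The projection `P_ℓ : ℝ^m → ℝ^ℓ` onto the first `ℓ` coordinates. -/
def firstCoords {ℓ m : ℕ} (h : ℓ ≤ m) : EuclideanSpace ℝ (Fin m) →ₗ[ℝ] EuclideanSpace ℝ (Fin ℓ) where
  toFun x := WithLp.toLp 2 fun i => x (Fin.castLE h i)
  map_add' _ _ := rfl
  map_smul' _ _ := rfl

section RIP

open scoped Matrix.Norms.Frobenius

/-- The matrix restricted isometry property of order `k` with constant `δ`; the norm of `X` is the
Frobenius norm, that of `M X` the Euclidean norm. -/
def MatrixRIP {m n₁ n₂ : ℕ} (k : ℕ) (δ : ℝ)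
    (M : Matrix (Fin n₁) (Fin n₂) ℝ →ₗ[ℝ] EuclideanSpace ℝ (Fin m)) : Prop :=
  ∀ X : Matrix (Fin n₁) (Fin n₂) ℝ, X.rank ≤ k →
    (1 - δ) * ‖X‖ ^ 2 ≤ ‖M X‖ ^ 2 ∧ ‖M X‖ ^ 2 ≤ (1 + δ) * ‖X‖ ^ 2

end RIP

end

/-! Let `B` be the first `ℓ` rows of the transposed orthogonal matrix, so `B Bᵀ = 1`. For fixed `X`,
the coordinates of `M X` are independent, centred and subgaussian with variance `‖X‖²`, and `ℓ`
times the squared norm of the subsampled image is the quadratic form of `Bᵀ B` in them. This form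
has mean `ℓ ‖X‖²`. A Hanson–Wright bound (`measureReal_abs_sum_sq_sub_le`) gives deviation
probability `exp(-const · t² ℓ)`. It depends on `ℓ` and not on `m`, because `Bᵀ` is an isometry on
`ℝ^ℓ` and `tr Bᵀ B = ℓ`. The diagonal of the form is a sum of independent centred squares; the rest
is decoupled and linearized with Gaussians.

Uniformity over rank at most `k` comes from writing `X = U W` through `ℝ^k`. The defect `‖T X‖² -
‖X‖²` is a quadratic form, so its polarization at two such products is linear in each of four
factors. Finite norming sets of sizes `5^(k n₁)` and `5^(k n₂)` control each factor up to 2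
(`abs_isometryDefect_le_of_norming`). A union bound over `25^(k(n₁+n₂))` quadruples is paid for by
half of the exponent. -/

open scoped ENNReal

/-! ### Gaussian exponential moments, in `ℝ≥0∞` so that Tonelli needs no integrability. -/

/-- The exponential, as an extended nonnegative real. -/
noncomputable def eexp (r : ℝ) : ℝ≥0∞ := ENNReal.ofReal (Real.exp r)

theorem eexp_add (a b : ℝ) : eexp (a + b) = eexp a * eexp b := by
  rw [eexp, Real.exp_add, ENNReal.ofReal_mul (Real.exp_nonneg _)]; rfl

theorem eexp_sum {ι : Type*} (s : Finset ι) (f : ι → ℝ) :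
    eexp (∑ i ∈ s, f i) = ∏ i ∈ s, eexp (f i) := by
  rw [eexp, Real.exp_sum, ENNReal.ofReal_prod_of_nonneg fun _ _ => Real.exp_nonneg _]; rfl

theorem eexp_le_eexp {a b : ℝ} (h : a ≤ b) : eexp a ≤ eexp b :=
  ENNReal.ofReal_le_ofReal (Real.exp_le_exp.2 h)

theorem eexp_ne_top (a : ℝ) : eexp a ≠ ∞ := ENNReal.ofReal_ne_top

@[fun_prop]
theorem measurable_eexp : Measurable eexp :=
  ENNReal.measurable_ofReal.comp Real.measurable_exp

theorem lintegral_eexp_mul_gaussianReal (a : ℝ) :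
    ∫⁻ t, eexp (a * t) ∂gaussianReal 0 1 = eexp (a ^ 2 / 2) := by
  have h := congrFun (mgf_fun_id_gaussianReal (μ := 0) (v := 1)) a
  rw [mgf] at h
  simp only [eexp]
  rw [← ofReal_integral_eq_lintegral_ofReal (integrable_exp_mul_gaussianReal a)
    (Filter.Eventually.of_forall fun _ => Real.exp_nonneg _), h]
  simp

theorem lintegral_eexp_sq_gaussianReal_le {s : ℝ} (hs : 0 ≤ s) (hs' : s ≤ 1 / 4) :
    ∫⁻ t, eexp (s * t ^ 2) ∂gaussianReal 0 1 ≤ eexp (2 * s) := by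
  have hb : 0 < 1 / 2 - s := by linarith
  rw [gaussianReal_of_var_ne_zero 0 one_ne_zero,
    lintegral_withDensity_eq_lintegral_mul _ (measurable_gaussianPDF 0 1) (by fun_prop)]
  have h1 : ∀ t : ℝ, (gaussianPDF 0 1 * fun t => eexp (s * t ^ 2)) t =
      ENNReal.ofReal ((√(2 * Real.pi))⁻¹ * Real.exp (-(1 / 2 - s) * t ^ 2)) := by
    intro t
    simp only [Pi.mul_apply, gaussianPDF, gaussianPDFReal, eexp]
    rw [← ENNReal.ofReal_mul (by positivity), mul_assoc, ← Real.exp_add]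
    congr 3
    · simp
    · simp; ring
  simp only [h1]
  rw [← ofReal_integral_eq_lintegral_ofReal
    ((integrable_exp_neg_mul_sq hb).const_mul _)
    (Filter.Eventually.of_forall fun _ => by positivity), integral_const_mul, integral_gaussian]
  refine ENNReal.ofReal_le_ofReal ?_
  have hpi := Real.pi_pos
  rw [← Real.sqrt_inv, ← Real.sqrt_mul (by positivity), Real.sqrt_le_left (Real.exp_nonneg _),
    ← Real.exp_nat_mul]
  have h2 : (2 * Real.pi)⁻¹ * (Real.pi / (1 / 2 - s)) = 1 / (1 - 2 * s) := by
    have : (1 - 2 * s) ≠ 0 := by linarith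
    field_simp
    try ring
  rw [h2, div_le_iff₀ (by linarith)]
  have h3 := Real.add_one_le_exp (4 * s)
  have h4 : ((2 : ℕ) : ℝ) * (2 * s) = 4 * s := by push_cast; ring
  rw [h4]
  -- With `exp (4s) ≥ 1 + 4s` it suffices that `(1 + 4s)(1 - 2s) = 1 + 2s(1 - 4s) ≥ 1`.
  nlinarith

/-- The standard Gaussian measure on `ℝ^ℓ`. -/
noncomputable abbrev gaussPi (ℓ : ℕ) : Measure (Fin ℓ → ℝ) :=
  Measure.pi fun _ => gaussianReal 0 1

theorem lintegral_prod_gaussPi {ℓ : ℕ} (f : Fin ℓ → ℝ → ℝ≥0∞) (hf : ∀ i, Measurable (f i)) :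
    ∫⁻ g, ∏ i, f i (g i) ∂gaussPi ℓ = ∏ i, ∫⁻ t, f i t ∂gaussianReal 0 1 := by
  refine (lintegral_prod_eq_prod_lintegral_of_indepFun Finset.univ
    (fun i (g : Fin ℓ → ℝ) => f i (g i)) (iIndepFun_pi fun i => (hf i).aemeasurable)
    fun i => (hf i).comp (measurable_pi_apply i)).trans ?_
  refine Finset.prod_congr rfl fun i _ => ?_
  exact (measurePreserving_eval (fun _ : Fin ℓ => gaussianReal 0 1) i).lintegral_comp (hf i)

theorem lintegral_eexp_linear_gaussPi {ℓ : ℕ} (a : Fin ℓ → ℝ) :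
    ∫⁻ g, eexp (∑ i, a i * g i) ∂gaussPi ℓ = eexp ((∑ i, a i ^ 2) / 2) := by
  simp only [eexp_sum]
  rw [lintegral_prod_gaussPi (fun i t => eexp (a i * t)) fun i => by fun_prop, Finset.sum_div,
    eexp_sum]
  simp only [lintegral_eexp_mul_gaussianReal]

theorem lintegral_eexp_sq_gaussPi_le {ℓ : ℕ} {s : ℝ} (hs : 0 ≤ s) (hs' : s ≤ 1 / 4) :
    ∫⁻ g, eexp (s * ∑ i, g i ^ 2) ∂gaussPi ℓ ≤ eexp (2 * s * ℓ) := by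
  simp only [Finset.mul_sum, eexp_sum]
  rw [lintegral_prod_gaussPi (fun _ t => eexp (s * t ^ 2)) fun i => by fun_prop]
  calc _ ≤ ∏ _i : Fin ℓ, eexp (2 * s) :=
        Finset.prod_le_prod' fun _ _ => lintegral_eexp_sq_gaussianReal_le hs hs'
    _ = eexp (2 * s * ℓ) := by rw [← eexp_sum]; simp [mul_comm]

/-! ### Exponential moments of subgaussian variables and of independent pairs. -/

section

variable {Ω : Type*} [MeasurableSpace Ω] {P : Measure Ω}

/-- Gaussian linearization: `exp (b x²)` is the mean of `exp (√(2b) g x)` over a standard Gaussian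
`g`. After exchanging integrals, the subgaussian bound applies for each fixed `g`. -/
theorem lintegral_eexp_sq_le_of_subgaussian [SFinite P] {X : Ω → ℝ} {c b : ℝ} (hX : Measurable X)
    (hsub : ∀ s, ∫⁻ ω, eexp (s * X ω) ∂P ≤ eexp (c * s ^ 2 / 2)) (hc : 0 ≤ c) (hb : 0 ≤ b)
    (hbc : b * c ≤ 1 / 4) :
    ∫⁻ ω, eexp (b * X ω ^ 2) ∂P ≤ eexp (2 * (b * c)) := by
  have h : ∀ x : ℝ, eexp (b * x ^ 2) = ∫⁻ t, eexp (√(2 * b) * t * x) ∂gaussianReal 0 1 := by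
    intro x
    simp_rw [mul_right_comm _ _ x]
    rw [lintegral_eexp_mul_gaussianReal, mul_pow, Real.sq_sqrt (by positivity)]
    congr 1; ring
  simp only [h]
  rw [lintegral_lintegral_swap (by fun_prop)]
  calc _ ≤ ∫⁻ t, eexp (b * c * t ^ 2) ∂gaussianReal 0 1 := by
        refine lintegral_mono fun t => (hsub _).trans (eexp_le_eexp (le_of_eq ?_))
        rw [mul_pow, Real.sq_sqrt (by positivity)]; ring
    _ ≤ _ := lintegral_eexp_sq_gaussianReal_le (by positivity) hbc

theorem lintegral_eexp_linear_le {ι : Type*} {ζ : ι → Ω → ℝ} {c : ℝ}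
    (hm : ∀ i, Measurable (ζ i)) (hind : iIndepFun ζ P)
    (hsub : ∀ i s, ∫⁻ ω, eexp (s * ζ i ω) ∂P ≤ eexp (c * s ^ 2 / 2)) (I : Finset ι) (w : ι → ℝ) :
    ∫⁻ ω, eexp (∑ i ∈ I, w i * ζ i ω) ∂P ≤ eexp (c / 2 * ∑ i ∈ I, w i ^ 2) := by
  simp only [eexp_sum, Finset.mul_sum]
  rw [lintegral_prod_eq_prod_lintegral_of_indepFun I (fun i ω => eexp (w i * ζ i ω))
    (hind.comp (fun i x => eexp (w i * x)) fun i => by fun_prop) fun i => by fun_prop]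
  refine Finset.prod_le_prod' fun i _ => (hsub i _).trans (eexp_le_eexp (le_of_eq (by ring)))

/-- Replaces conditioning on `W`: the inner integral has `W` frozen at an independent outcome. -/
theorem lintegral_indepFun_eq {α β : Type*} [MeasurableSpace α] [MeasurableSpace β]
    [IsFiniteMeasure P]
    {U : Ω → α} {W : Ω → β} (hU : Measurable U) (hW : Measurable W) (h : IndepFun U W P)
    {F : α → β → ℝ≥0∞} (hF : Measurable (Function.uncurry F)) :
    ∫⁻ ω, F (U ω) (W ω) ∂P = ∫⁻ ω', ∫⁻ ω, F (U ω) (W ω') ∂P ∂P := by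
  have h1 : ∫⁻ ω, F (U ω) (W ω) ∂P =
      ∫⁻ p, Function.uncurry F p ∂(P.map fun ω => (U ω, W ω)) := by
    rw [lintegral_map hF (hU.prodMk hW)]; rfl
  rw [h1, (indepFun_iff_map_prod_eq_prod_map_map hU.aemeasurable hW.aemeasurable).1 h,
    lintegral_prod_symm _ hF.aemeasurable, lintegral_map hF.lintegral_prod_left' hW]
  refine lintegral_congr fun ω' => ?_
  exact lintegral_map (hF.comp (by fun_prop : Measurable fun x : α => (x, W ω'))) hU

end

/-! ### Decoupling of off-diagonal sums by averaging over subsets. -/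

section Decoupling

variable {ι : Type*} [Fintype ι] [DecidableEq ι]

/-- A quarter of all subsets of a finite type contain `i` and do not contain `j ≠ i`. -/
theorem four_mul_sum_mem_notMem {i j : ι} (hij : i ≠ j) :
    4 * ∑ I : Finset ι, (if i ∈ I ∧ j ∉ I then (1 : ℝ) else 0) = 2 ^ Fintype.card ι := by
  set f : Finset ι → ℝ := fun I => if i ∈ I ∧ j ∉ I then 1 else 0
  have flip : ∀ s : Finset ι, ∑ I, f (symmDiff s I) = ∑ I, f I := fun s =>
    Equiv.sum_comp (symmDiff_right_involutive s).toPerm f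
  -- The four translates of `I` realize the four membership patterns of `i` and `j`, and exactly one
  -- of these counts.
  have h : ∀ I, f I + f (symmDiff {i} I) + f (symmDiff {j} I) + f (symmDiff {i, j} I) = 1 := by
    intro I
    by_cases hi : i ∈ I <;> by_cases hj : j ∈ I <;>
      simp [f, Finset.mem_symmDiff, hi, hj, hij, hij.symm]
  have h2 : ∑ I, (f I + f (symmDiff {i} I) + f (symmDiff {j} I) + f (symmDiff {i, j} I)) =
      2 ^ Fintype.card ι := by
    simp [h]
  simp only [Finset.sum_add_distrib, flip] at h2
  linarith

theorem sum_offDiag_eq_average (q : ι → ι → ℝ) :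
    ∑ i, ∑ j, (if i = j then 0 else q i j) =
      ∑ I : Finset ι, (2 ^ Fintype.card ι : ℝ)⁻¹ * (4 * ∑ i ∈ I, ∑ j ∈ Iᶜ, q i j) := by
  have h1 : ∀ I : Finset ι, ∑ i ∈ I, ∑ j ∈ Iᶜ, q i j =
      ∑ i, ∑ j, (if i ∈ I ∧ j ∉ I then (1 : ℝ) else 0) * q i j := by
    intro I
    simp [ite_and, Finset.sum_ite, Finset.compl_eq_univ_sdiff, Finset.filter_not]
  simp only [h1]
  rw [← Finset.mul_sum, ← Finset.mul_sum, Finset.sum_comm (s := Finset.univ (α := Finset ι)),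
    Finset.mul_sum, Finset.mul_sum]
  refine Finset.sum_congr rfl fun i _ => ?_
  rw [Finset.sum_comm, Finset.mul_sum, Finset.mul_sum]
  refine Finset.sum_congr rfl fun j _ => ?_
  rw [← Finset.sum_mul, ← mul_assoc 4]
  split_ifs with hij
  · subst hij
    simp
  · rw [four_mul_sum_mem_notMem hij, inv_mul_cancel_left₀ (by positivity)]

/-- Jensen's inequality for the uniform average over `I`. In each term the two index blocks are
disjoint, hence independent for independent variables. -/
theorem exp_sum_offDiag_le_average (q : ι → ι → ℝ) :
    Real.exp (∑ i, ∑ j, (if i = j then 0 else q i j)) ≤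
      ∑ I : Finset ι, (2 ^ Fintype.card ι : ℝ)⁻¹ * Real.exp (4 * ∑ i ∈ I, ∑ j ∈ Iᶜ, q i j) := by
  rw [sum_offDiag_eq_average]
  refine convexOn_exp.map_sum_le (t := Finset.univ) (w := fun _ => (2 ^ Fintype.card ι : ℝ)⁻¹)
    (fun _ _ => by positivity) ?_ fun _ _ => Set.mem_univ _
  simp

end Decoupling

/-! ### The off-diagonal part of the quadratic form of `Bᵀ B`. -/

section Projection

variable {ℓ m : ℕ} {B : Matrix (Fin ℓ) (Fin m) ℝ}

theorem sum_sq_transpose_mulVec (hB : B * B.transpose = 1) (g : Fin ℓ → ℝ) :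
    ∑ i, (∑ a, B a i * g a) ^ 2 = ∑ a, g a ^ 2 := by
  have h1 : ∑ i, (∑ a, B a i * g a) ^ 2 =
      dotProduct (Matrix.vecMul g B) (Matrix.vecMul g B) := by
    simp [dotProduct, Matrix.vecMul, sq, mul_comm]
  rw [h1, ← Matrix.mulVec_transpose B g, Matrix.dotProduct_mulVec, Matrix.vecMul_mulVec]
  simp [hB, dotProduct, sq]

/-- The sum `s` is a diagonal entry of `Bᵀ B`. Applying the isometry `Bᵀ` to column `i` gives a
vector of squared norm `s` whose `i`-th coordinate is `s`, so `s² ≤ s`. -/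
theorem sum_sq_col_le_one (hB : B * B.transpose = 1) (i : Fin m) : ∑ a, B a i ^ 2 ≤ 1 := by
  set s := ∑ a, B a i ^ 2
  have h := sum_sq_transpose_mulVec hB fun a => B a i
  have h2 : (∑ a, B a i * B a i) ^ 2 ≤ ∑ j, (∑ a, B a j * B a i) ^ 2 :=
    Finset.single_le_sum (f := fun j => (∑ a, B a j * B a i) ^ 2) (fun _ _ => sq_nonneg _)
      (Finset.mem_univ i)
  rw [h] at h2
  simp only [← sq] at h2
  change s ^ 2 ≤ s at h2
  nlinarith

theorem sum_sum_sq_eq (hB : B * B.transpose = 1) : ∑ i, ∑ a, B a i ^ 2 = ℓ := by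
  rw [Finset.sum_comm]
  have : ∀ a, ∑ i, B a i ^ 2 = 1 := by
    intro a
    have := congrFun (congrFun hB a) a
    simpa [Matrix.mul_apply, sq] using this
  simp [this]

variable {Ω : Type*} [MeasurableSpace Ω] {P : Measure Ω} [IsProbabilityMeasure P]
  {ζ : Fin m → Ω → ℝ} {c : ℝ}

/-- Gaussian linearization of the square of a projection of a subgaussian vector. -/
theorem lintegral_eexp_sum_sq_le (hB : B * B.transpose = 1)
    (hm : ∀ i, Measurable (ζ i)) (hind : iIndepFun ζ P)
    (hsub : ∀ i s, ∫⁻ ω, eexp (s * ζ i ω) ∂P ≤ eexp (c * s ^ 2 / 2)) (hc : 0 ≤ c)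
    (J : Finset (Fin m)) {b : ℝ} (hb : 0 ≤ b) (hbc : b * c ≤ 1 / 4) :
    ∫⁻ ω, eexp (b * ∑ a, (∑ j ∈ J, B a j * ζ j ω) ^ 2) ∂P ≤ eexp (2 * (b * c) * ℓ) := by
  have h : ∀ ω, eexp (b * ∑ a, (∑ j ∈ J, B a j * ζ j ω) ^ 2) =
      ∫⁻ g, eexp (∑ j ∈ J, (√(2 * b) * ∑ a, B a j * g a) * ζ j ω) ∂gaussPi ℓ := by
    intro ω
    have h1 : ∀ g : Fin ℓ → ℝ, ∑ j ∈ J, (√(2 * b) * ∑ a, B a j * g a) * ζ j ω =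
        ∑ a, (√(2 * b) * ∑ j ∈ J, B a j * ζ j ω) * g a := by
      intro g
      simp only [Finset.mul_sum, Finset.sum_mul]
      rw [Finset.sum_comm]
      exact Finset.sum_congr rfl fun _ _ => Finset.sum_congr rfl fun _ _ => by ring
    simp only [h1]
    rw [lintegral_eexp_linear_gaussPi]
    congr 1
    simp only [mul_pow, Real.sq_sqrt (show 0 ≤ 2 * b by positivity), ← Finset.mul_sum]
    ring
  simp only [h]
  rw [lintegral_lintegral_swap (by fun_prop)]
  calc _ ≤ ∫⁻ g, eexp (b * c * ∑ a, g a ^ 2) ∂gaussPi ℓ := by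
        refine lintegral_mono fun g => (lintegral_eexp_linear_le hm hind hsub J _).trans ?_
        refine eexp_le_eexp ?_
        rw [← sum_sq_transpose_mulVec hB g]
        -- Enlarging `J` to all coordinates lets the isometry `Bᵀ` apply; only the dimension `ℓ` of
        -- `g` remains.
        calc _ ≤ c / 2 * ∑ j, (√(2 * b) * ∑ a, B a j * g a) ^ 2 := by
              refine mul_le_mul_of_nonneg_left ?_ (by positivity)
              exact Finset.sum_le_sum_of_subset_of_nonneg (Finset.subset_univ J)
                fun _ _ _ => sq_nonneg _
          _ = _ := by
              simp only [mul_pow, Real.sq_sqrt (show 0 ≤ 2 * b by positivity), ← Finset.mul_sum]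
              ring
    _ ≤ _ := lintegral_eexp_sq_gaussPi_le (by positivity) hbc

/-- The exponential moment of the part of the quadratic form of `Bᵀ B` between two complementary
blocks of coordinates. -/
theorem lintegral_eexp_block_le (hB : B * B.transpose = 1)
    (hm : ∀ i, Measurable (ζ i)) (hind : iIndepFun ζ P)
    (hsub : ∀ i s, ∫⁻ ω, eexp (s * ζ i ω) ∂P ≤ eexp (c * s ^ 2 / 2)) (hc : 0 ≤ c)
    (I : Finset (Fin m)) {μ : ℝ} (hμ : μ ^ 2 * c ^ 2 ≤ 1 / 2) :
    ∫⁻ ω, eexp (∑ i ∈ I, ∑ j ∈ Iᶜ, μ * (∑ a, B a i * B a j) * (ζ i ω * ζ j ω)) ∂P ≤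
      eexp (μ ^ 2 * c ^ 2 * ℓ) := by
  -- With the block `Iᶜ` frozen at `y`, the form is linear in the block `I`, with coefficients `w y
  -- = μ Bᵀ (B y)`, where `y` is cut off to `Iᶜ`. Hence `∑ w² = μ² ‖B y‖²`.
  set w : (Fin m → ℝ) → Fin m → ℝ := fun y i =>
    μ * ∑ a, B a i * ∑ j ∈ Iᶜ, B a j * y j with hw
  have h1 : ∀ ω, ∑ i ∈ I, ∑ j ∈ Iᶜ, μ * (∑ a, B a i * B a j) * (ζ i ω * ζ j ω) =
      ∑ i ∈ I, w (fun j => ζ j ω) i * ζ i ω := by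
    intro ω
    refine Finset.sum_congr rfl fun i _ => ?_
    simp only [hw, Finset.mul_sum, Finset.sum_mul]
    rw [Finset.sum_comm]
    exact Finset.sum_congr rfl fun _ _ => Finset.sum_congr rfl fun _ _ => by ring
  have hInd := hind.indepFun_finset I Iᶜ disjoint_compl_right hm
  have h2 : ∫⁻ ω, eexp (∑ i ∈ I, w (fun j => ζ j ω) i * ζ i ω) ∂P =
      ∫⁻ ω', ∫⁻ ω, eexp (∑ i ∈ I, w (fun j => ζ j ω') i * ζ i ω) ∂P ∂P := by
    let F : (I → ℝ) → ((Iᶜ : Finset (Fin m)) → ℝ) → ℝ≥0∞ := fun x y =>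
      eexp (∑ i : I, (μ * ∑ a, B a i * ∑ j : (Iᶜ : Finset (Fin m)), B a j * y j) * x i)
    have hF : ∀ ω ω', F (fun i => ζ i ω) (fun j => ζ j ω') =
        eexp (∑ i ∈ I, w (fun j => ζ j ω') i * ζ i ω) := by
      intro ω ω'
      simp only [F, hw]
      rw [← Finset.sum_coe_sort I]
      congr 1
      refine Finset.sum_congr rfl fun i _ => ?_
      congr 2
      refine Finset.sum_congr rfl fun a _ => ?_
      rw [← Finset.sum_coe_sort Iᶜ]
    simp only [← hF]
    exact lintegral_indepFun_eq (F := F) (by fun_prop) (by fun_prop) hInd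
      (by simp only [F, Function.uncurry_def]; fun_prop)
  simp only [h1]
  rw [h2]
  calc _ ≤ ∫⁻ ω', eexp ((μ ^ 2 * c / 2) * ∑ a, (∑ j ∈ Iᶜ, B a j * ζ j ω') ^ 2) ∂P := by
        refine lintegral_mono fun ω' => (lintegral_eexp_linear_le hm hind hsub I _).trans ?_
        refine eexp_le_eexp ?_
        rw [← sum_sq_transpose_mulVec hB fun a => ∑ j ∈ Iᶜ, B a j * ζ j ω']
        calc _ ≤ c / 2 * ∑ i, w (fun j => ζ j ω') i ^ 2 := by
              refine mul_le_mul_of_nonneg_left ?_ (by positivity)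
              exact Finset.sum_le_sum_of_subset_of_nonneg (Finset.subset_univ I)
                fun _ _ _ => sq_nonneg _
          _ = _ := by
              simp only [hw, mul_pow, ← Finset.mul_sum]
              ring
    _ ≤ _ := lintegral_eexp_sum_sq_le hB hm hind hsub hc Iᶜ (by positivity) (by linarith)
    _ = _ := by congr 1; ring

/-- The decoupling factor 4 multiplies `μ`, which gives 16 in the quadratic exponent of the block
bound. -/
theorem lintegral_eexp_offDiag_le (hB : B * B.transpose = 1)
    (hm : ∀ i, Measurable (ζ i)) (hind : iIndepFun ζ P)
    (hsub : ∀ i s, ∫⁻ ω, eexp (s * ζ i ω) ∂P ≤ eexp (c * s ^ 2 / 2)) (hc : 0 ≤ c)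
    {μ : ℝ} (hμ : 16 * (μ ^ 2 * c ^ 2) ≤ 1 / 2) :
    ∫⁻ ω, eexp (∑ i, ∑ j, (if i = j then 0 else
      μ * (∑ a, B a i * B a j) * (ζ i ω * ζ j ω))) ∂P ≤ eexp (16 * (μ ^ 2 * c ^ 2) * ℓ) := by
  set N : ℝ := 2 ^ Fintype.card (Fin m) with hN
  have hN0 : 0 < N := by positivity
  calc _ ≤ ∫⁻ ω, ∑ I : Finset (Fin m), ENNReal.ofReal N⁻¹ *
        eexp (∑ i ∈ I, ∑ j ∈ Iᶜ, (4 * μ) * (∑ a, B a i * B a j) * (ζ i ω * ζ j ω)) ∂P := by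
        refine lintegral_mono fun ω => ?_
        refine (ENNReal.ofReal_le_ofReal (exp_sum_offDiag_le_average _)).trans (le_of_eq ?_)
        rw [ENNReal.ofReal_sum_of_nonneg fun _ _ => by positivity]
        refine Finset.sum_congr rfl fun I _ => ?_
        rw [ENNReal.ofReal_mul (by positivity), eexp, Finset.mul_sum]
        congr 3
        refine Finset.sum_congr rfl fun i _ => ?_
        rw [Finset.mul_sum]
        exact Finset.sum_congr rfl fun j _ => by ring
    _ = ∑ I : Finset (Fin m), ENNReal.ofReal N⁻¹ * ∫⁻ ω,
        eexp (∑ i ∈ I, ∑ j ∈ Iᶜ, (4 * μ) * (∑ a, B a i * B a j) * (ζ i ω * ζ j ω)) ∂P := by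
        rw [lintegral_finsetSum _ fun I _ => by fun_prop]
        exact Finset.sum_congr rfl fun I _ => lintegral_const_mul _ (by fun_prop)
    _ ≤ ∑ _I : Finset (Fin m), ENNReal.ofReal N⁻¹ * eexp (16 * (μ ^ 2 * c ^ 2) * ℓ) := by
        refine Finset.sum_le_sum fun I _ => ?_
        gcongr
        refine (lintegral_eexp_block_le hB hm hind hsub hc I (by linarith)).trans (le_of_eq ?_)
        congr 1; ring
    _ = _ := by
        rw [Finset.sum_const, nsmul_eq_mul, ← mul_assoc, Finset.card_univ, Fintype.card_finset,
          ← ENNReal.ofReal_natCast, ← ENNReal.ofReal_mul (by positivity)]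
        push_cast
        rw [← hN, mul_inv_cancel₀ hN0.ne']
        simp

end Projection

/-! ### Centred squares, the diagonal part, and the Hanson–Wright inequality. -/

theorem Real.exp_le_one_add_add_sq_mul_exp_abs (y : ℝ) :
    Real.exp y ≤ 1 + y + y ^ 2 * Real.exp |y| := by
  have h1 : 1 ≤ Real.exp |y| := Real.one_le_exp (abs_nonneg y)
  rcases le_or_gt |y| 1 with h | h
  · have := (abs_le.1 (Real.abs_exp_sub_one_sub_id_le h)).2
    nlinarith [sq_nonneg y]
  · rcases lt_abs.1 h with h' | h'
    · rw [abs_of_pos (by linarith)] at h1 ⊢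
      nlinarith [mul_nonneg (show 0 ≤ y ^ 2 - 1 by nlinarith) (Real.exp_nonneg y)]
    · have : Real.exp y ≤ 1 := Real.exp_le_one_iff.2 (by linarith)
      nlinarith [sq_nonneg y]

section

variable {Ω : Type*} [MeasurableSpace Ω] {P : Measure Ω}

/-- Chernoff's bound. -/
theorem measureReal_le_exp_of_lintegral_eexp_le {f : Ω → ℝ} {a s : ℝ} (hf : Measurable f)
    (h : ∫⁻ ω, eexp (f ω) ∂P ≤ eexp a) : P.real {ω | s ≤ f ω} ≤ Real.exp (a - s) := by
  refine ENNReal.toReal_le_of_le_ofReal (Real.exp_nonneg _) ?_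
  have h1 : P {ω | s ≤ f ω} ≤ P {ω | eexp s ≤ eexp (f ω)} :=
    measure_mono fun ω hω => eexp_le_eexp hω
  refine h1.trans ((meas_ge_le_lintegral_div (by fun_prop) ?_ (eexp_ne_top s)).trans ?_)
  · simp [eexp, Real.exp_pos]
  · refine ENNReal.div_le_of_le_mul (h.trans (le_of_eq ?_))
    change _ = eexp _ * _
    rw [← eexp_add]; congr 1; ring

theorem integrable_exp_of_lintegral_eexp_le {f : Ω → ℝ} {a : ℝ} (hf : Measurable f)
    (h : ∫⁻ ω, eexp (f ω) ∂P ≤ eexp a) :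
    Integrable (fun ω => Real.exp (f ω)) P ∧ ∫ ω, Real.exp (f ω) ∂P ≤ Real.exp a := by
  have hi : Integrable (fun ω => Real.exp (f ω)) P := by
    refine ⟨(by fun_prop), ?_⟩
    rw [hasFiniteIntegral_iff_ofReal (Filter.Eventually.of_forall fun _ => Real.exp_nonneg _)]
    exact h.trans_lt (eexp_ne_top a).lt_top
  refine ⟨hi, ?_⟩
  rw [integral_eq_lintegral_of_nonneg_ae (Filter.Eventually.of_forall fun _ => Real.exp_nonneg _)
    (by fun_prop)]
  exact ENNReal.toReal_le_of_le_ofReal (Real.exp_nonneg a) h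

variable [IsProbabilityMeasure P]

/-- The centered square of a subgaussian random variable is subexponential. -/
theorem lintegral_eexp_sq_sub_le {X : Ω → ℝ} {c v μ : ℝ} (hX : Measurable X)
    (hsub : ∀ s, ∫⁻ ω, eexp (s * X ω) ∂P ≤ eexp (c * s ^ 2 / 2)) (hc : 0 < c)
    (hv : ∫ ω, X ω ^ 2 ∂P = v) (hvc : v ≤ c) (hμ : |μ| * (8 * c) ≤ 1) :
    ∫⁻ ω, eexp (μ * (X ω ^ 2 - v)) ∂P ≤ eexp (384 * c ^ 2 * μ ^ 2) := by
  have hv0 : 0 ≤ v := hv ▸ integral_nonneg fun _ => sq_nonneg _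
  have hexp := lintegral_eexp_sq_le_of_subgaussian hX hsub hc.le (b := 1 / (4 * c)) (by positivity)
    (by field_simp; norm_num)
  obtain ⟨hWi, hW⟩ := integrable_exp_of_lintegral_eexp_le (by fun_prop) hexp
  have hX2 : Integrable (fun ω => X ω ^ 2) P := by
    refine (hWi.const_mul (4 * c)).mono' (by fun_prop) (Filter.Eventually.of_forall fun ω => ?_)
    rw [Real.norm_of_nonneg (sq_nonneg _)]
    have h := Real.add_one_le_exp (1 / (4 * c) * X ω ^ 2)
    have h2 : X ω ^ 2 = 4 * c * (1 / (4 * c) * X ω ^ 2) := by field_simp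
    calc X ω ^ 2 = 4 * c * (1 / (4 * c) * X ω ^ 2) := h2
      _ ≤ _ := by
        refine mul_le_mul_of_nonneg_left (by linarith) (by positivity)
  have hpt : ∀ ω, Real.exp (μ * (X ω ^ 2 - v)) ≤ 1 + μ * (X ω ^ 2 - v) +
      128 * c ^ 2 * μ ^ 2 * Real.exp (1 / 4) * Real.exp (1 / (4 * c) * X ω ^ 2) := by
    intro ω
    set z := X ω ^ 2 - v with hz
    have hzabs : |z| ≤ X ω ^ 2 + v := by
      rw [abs_le]; constructor <;> nlinarith [sq_nonneg (X ω)]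
    -- The scale `8c` serves three bounds: `|μ z| ≤ u`, `z² = 64 c² u² ≤ 128 c² exp u`, and, as `v ≤
    -- c`, `2u ≤ 1/4 + X²/(4c)`.
    set u := |z| / (8 * c) with hu
    have hu0 : 0 ≤ u := by positivity
    have h1 : |μ * z| ≤ u := by
      rw [abs_mul, hu, le_div_iff₀ (by positivity)]
      nlinarith [abs_nonneg z]
    have h2 : (μ * z) ^ 2 = (64 * c ^ 2 * μ ^ 2) * u ^ 2 := by
      rw [hu, div_pow, sq_abs]; field_simp; ring
    have h3 : u ^ 2 ≤ 2 * Real.exp u := by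
      have := Real.quadratic_le_exp_of_nonneg hu0
      linarith
    have h4 : Real.exp u * Real.exp u ≤
        Real.exp (1 / 4) * Real.exp (1 / (4 * c) * X ω ^ 2) := by
      rw [← Real.exp_add, ← Real.exp_add]
      refine Real.exp_le_exp.2 ?_
      have : u + u = |z| / (4 * c) := by rw [hu]; field_simp; ring
      rw [this, div_le_iff₀ (by positivity)]
      have h5 : (1 / 4 + 1 / (4 * c) * X ω ^ 2) * (4 * c) = c + X ω ^ 2 := by field_simp
      rw [h5]; linarith
    calc Real.exp (μ * z) ≤ 1 + μ * z + (μ * z) ^ 2 * Real.exp |μ * z| :=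
          Real.exp_le_one_add_add_sq_mul_exp_abs _
      _ ≤ 1 + μ * z + (64 * c ^ 2 * μ ^ 2) * (2 * Real.exp u) * Real.exp u := by
          rw [h2]; gcongr
      _ = 1 + μ * z + (128 * c ^ 2 * μ ^ 2) * (Real.exp u * Real.exp u) := by ring
      _ ≤ 1 + μ * z + (128 * c ^ 2 * μ ^ 2) *
          (Real.exp (1 / 4) * Real.exp (1 / (4 * c) * X ω ^ 2)) := by gcongr
      _ = _ := by ring
  have hi1 : Integrable (fun ω => 1 + μ * (X ω ^ 2 - v)) P := by fun_prop
  have hi2 := hWi.const_mul (128 * c ^ 2 * μ ^ 2 * Real.exp (1 / 4))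
  have hiz : Integrable (fun ω => X ω ^ 2 - v) P := by fun_prop
  -- Centring removes the linear term; `384 = 128 · 3`, with `exp (1/4) · exp (1/2) ≤ 3`.
  have hint : ∫ ω, (1 + μ * (X ω ^ 2 - v) + 128 * c ^ 2 * μ ^ 2 * Real.exp (1 / 4) *
      Real.exp (1 / (4 * c) * X ω ^ 2)) ∂P ≤ 1 + 384 * c ^ 2 * μ ^ 2 := by
    rw [integral_add hi1 hi2, integral_add (by fun_prop) (hiz.const_mul μ), integral_const_mul,
      integral_const_mul, integral_sub hX2 (by fun_prop), hv]
    have h6 : Real.exp (1 / 4) * ∫ ω, Real.exp (1 / (4 * c) * X ω ^ 2) ∂P ≤ 3 := by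
      calc _ ≤ Real.exp (1 / 4) * Real.exp (2 * (1 / (4 * c) * c)) := by gcongr
        _ ≤ Real.exp 1 := by
          rw [← Real.exp_add]
          refine Real.exp_le_exp.2 ?_
          have : 1 / (4 * c) * c = 1 / 4 := by field_simp
          rw [this]; norm_num
        _ ≤ 3 := by linarith [Real.exp_one_lt_d9]
    have h7 : 128 * c ^ 2 * μ ^ 2 * (Real.exp (1 / 4) *
        ∫ ω, Real.exp (1 / (4 * c) * X ω ^ 2) ∂P) ≤ 128 * c ^ 2 * μ ^ 2 * 3 := by gcongr
    simp only [integral_const, probReal_univ, one_smul, sub_self, mul_zero, add_zero]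
    linarith
  calc _ ≤ ∫⁻ ω, ENNReal.ofReal (1 + μ * (X ω ^ 2 - v) + 128 * c ^ 2 * μ ^ 2 *
        Real.exp (1 / 4) * Real.exp (1 / (4 * c) * X ω ^ 2)) ∂P :=
        lintegral_mono fun ω => ENNReal.ofReal_le_ofReal (hpt ω)
    _ = ENNReal.ofReal (∫ ω, (1 + μ * (X ω ^ 2 - v) + 128 * c ^ 2 * μ ^ 2 * Real.exp (1 / 4) *
      Real.exp (1 / (4 * c) * X ω ^ 2)) ∂P) :=
        (ofReal_integral_eq_lintegral_ofReal (hi1.add hi2) (Filter.Eventually.of_forall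
          fun ω => (Real.exp_nonneg _).trans (hpt ω))).symm
    _ ≤ _ := by
        refine ENNReal.ofReal_le_ofReal (hint.trans ?_)
        rw [add_comm]
        exact Real.add_one_le_exp _

variable {ℓ m : ℕ} {B : Matrix (Fin ℓ) (Fin m) ℝ} {ζ : Fin m → Ω → ℝ} {c v : ℝ}

/-- The weights `q = ∑ a, B a i ^ 2` satisfy `q² ≤ q` and sum to `ℓ`, so the product of the
one-variable bounds has an exponent linear in `ℓ`. -/
theorem lintegral_eexp_diag_le (hB : B * B.transpose = 1)
    (hm : ∀ i, Measurable (ζ i)) (hind : iIndepFun ζ P)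
    (hsub : ∀ i s, ∫⁻ ω, eexp (s * ζ i ω) ∂P ≤ eexp (c * s ^ 2 / 2)) (hc : 0 < c)
    (hv : ∀ i, ∫ ω, ζ i ω ^ 2 ∂P = v) (hvc : v ≤ c) {μ : ℝ} (hμ : |μ| * (8 * c) ≤ 1) :
    ∫⁻ ω, eexp (∑ i, μ * (∑ a, B a i ^ 2) * (ζ i ω ^ 2 - v)) ∂P ≤
      eexp (384 * c ^ 2 * μ ^ 2 * ℓ) := by
  simp only [eexp_sum]
  rw [lintegral_prod_eq_prod_lintegral_of_indepFun Finset.univ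
    (fun i ω => eexp (μ * (∑ a, B a i ^ 2) * (ζ i ω ^ 2 - v)))
    (hind.comp (fun i x => eexp (μ * (∑ a, B a i ^ 2) * (x ^ 2 - v))) fun i => by fun_prop)
    fun i => by fun_prop, ← sum_sum_sq_eq hB, Finset.mul_sum, eexp_sum]
  refine Finset.prod_le_prod' fun i _ => ?_
  have h0 : 0 ≤ ∑ a, B a i ^ 2 := Finset.sum_nonneg fun _ _ => sq_nonneg _
  have h1 := sum_sq_col_le_one hB i
  set q := ∑ a, B a i ^ 2
  refine (lintegral_eexp_sq_sub_le (hm i) (hsub i) hc (hv i) hvc ?_).trans (eexp_le_eexp ?_)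
  · rw [abs_mul, abs_of_nonneg h0]
    have := mul_le_mul_of_nonneg_left h1 (abs_nonneg μ)
    nlinarith
  · rw [mul_pow, ← mul_assoc]
    refine mul_le_mul_of_nonneg_left ?_ (by positivity)
    nlinarith

theorem sum_sq_eq_diag_add_offDiag (y : Fin m → ℝ) :
    ∑ a, (∑ i, B a i * y i) ^ 2 = ∑ i, (∑ a, B a i ^ 2) * y i ^ 2 +
      ∑ i, ∑ j, (if i = j then 0 else (∑ a, B a i * B a j) * (y i * y j)) := by
  have h1 : ∑ a, (∑ i, B a i * y i) ^ 2 = ∑ i, ∑ j, (∑ a, B a i * B a j) * (y i * y j) := by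
    simp only [sq, Finset.sum_mul, Finset.mul_sum]
    rw [Finset.sum_comm]
    refine Finset.sum_congr rfl fun i _ => ?_
    rw [Finset.sum_comm]
    exact Finset.sum_congr rfl fun _ _ => Finset.sum_congr rfl fun _ _ => by ring
  rw [h1, ← Finset.sum_add_distrib]
  refine Finset.sum_congr rfl fun i _ => ?_
  rw [← Finset.add_sum_erase _ _ (Finset.mem_univ i),
    ← Finset.add_sum_erase _ (fun j => if i = j then 0 else _) (Finset.mem_univ i)]
  simp only [if_true, zero_add, ← sq]
  congr 1
  refine Finset.sum_congr rfl fun j hj => ?_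
  rw [if_neg (Finset.ne_of_mem_erase hj).symm]

/-- The diagonal and off-diagonal parts are dependent, so they are separated by `exp ((D + S)/2) ≤
(exp D + exp S)/2`. This doubles `μ` in each part, whence `1536 = 4 · 384`. -/
theorem lintegral_eexp_sum_sq_sub_le (hB : B * B.transpose = 1)
    (hm : ∀ i, Measurable (ζ i)) (hind : iIndepFun ζ P)
    (hsub : ∀ i s, ∫⁻ ω, eexp (s * ζ i ω) ∂P ≤ eexp (c * s ^ 2 / 2)) (hc : 0 < c)
    (hv : ∀ i, ∫ ω, ζ i ω ^ 2 ∂P = v) (hvc : v ≤ c) {μ : ℝ} (hμ : |μ| * (16 * c) ≤ 1) :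
    ∫⁻ ω, eexp (μ * (∑ a, (∑ i, B a i * ζ i ω) ^ 2 - ℓ * v)) ∂P ≤
      eexp (1536 * c ^ 2 * μ ^ 2 * ℓ) := by
  set D : Ω → ℝ := fun ω => ∑ i, (2 * μ) * (∑ a, B a i ^ 2) * (ζ i ω ^ 2 - v) with hD
  set S : Ω → ℝ := fun ω => ∑ i, ∑ j, (if i = j then 0 else
      (2 * μ) * (∑ a, B a i * B a j) * (ζ i ω * ζ j ω)) with hS
  have h2abs : |2 * μ| = 2 * |μ| := by rw [abs_mul]; norm_num
  have hDle : ∫⁻ ω, eexp (D ω) ∂P ≤ eexp (1536 * c ^ 2 * μ ^ 2 * ℓ) :=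
    (lintegral_eexp_diag_le hB hm hind hsub hc hv hvc (μ := 2 * μ)
      (by rw [h2abs]; linarith)).trans (eexp_le_eexp (le_of_eq (by ring)))
  have hμc : μ ^ 2 * c ^ 2 ≤ 1 / 256 := by
    have h : (|μ| * c) ^ 2 ≤ (1 / 16) ^ 2 := pow_le_pow_left₀ (by positivity) (by linarith) 2
    rw [mul_pow, sq_abs] at h
    norm_num at h ⊢; exact h
  have hSle : ∫⁻ ω, eexp (S ω) ∂P ≤ eexp (1536 * c ^ 2 * μ ^ 2 * ℓ) := by
    refine (lintegral_eexp_offDiag_le hB hm hind hsub hc.le (μ := 2 * μ)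
      (by linarith)).trans (eexp_le_eexp ?_)
    refine mul_le_mul_of_nonneg_right ?_ (by positivity)
    nlinarith [mul_nonneg (sq_nonneg μ) (sq_nonneg c)]
  have hsum : ∀ ω, μ * (∑ a, (∑ i, B a i * ζ i ω) ^ 2 - ℓ * v) = (D ω + S ω) / 2 := by
    intro ω
    have hd : D ω = (2 * μ) * (∑ i, (∑ a, B a i ^ 2) * ζ i ω ^ 2 - ℓ * v) := by
      rw [← sum_sum_sq_eq hB, Finset.sum_mul, ← Finset.sum_sub_distrib, Finset.mul_sum]
      exact Finset.sum_congr rfl fun _ _ => by ring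
    have hs : S ω = (2 * μ) * ∑ i, ∑ j, (if i = j then 0 else
        (∑ a, B a i * B a j) * (ζ i ω * ζ j ω)) := by
      simp only [Finset.mul_sum, mul_ite, mul_zero]
      refine Finset.sum_congr rfl fun i _ => Finset.sum_congr rfl fun j _ => ?_
      split_ifs
      · rfl
      · rw [Finset.sum_mul]; simp only [Finset.mul_sum, Finset.sum_mul, mul_assoc]
    rw [sum_sq_eq_diag_add_offDiag, hd, hs]
    ring
  have hmeasD : Measurable D := by fun_prop
  have hmeasS : Measurable S := by
    simp only [hS]
    refine Finset.measurable_sum _ fun i _ => Finset.measurable_sum _ fun j _ => ?_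
    split_ifs <;> fun_prop
  calc _ ≤ ∫⁻ ω, (ENNReal.ofReal (1 / 2) * eexp (D ω) + ENNReal.ofReal (1 / 2) * eexp (S ω)) ∂P := by
        refine lintegral_mono fun ω => ?_
        simp only [hsum, eexp]
        rw [← ENNReal.ofReal_mul (by norm_num), ← ENNReal.ofReal_mul (by norm_num),
          ← ENNReal.ofReal_add (by positivity) (by positivity)]
        refine ENNReal.ofReal_le_ofReal ?_
        have h : (D ω + S ω) / 2 = D ω / 2 + S ω / 2 := by ring
        have hd2 : Real.exp (D ω) = Real.exp (D ω / 2) ^ 2 := by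
          rw [← Real.exp_nat_mul]; congr 1; push_cast; ring
        have hs2 : Real.exp (S ω) = Real.exp (S ω / 2) ^ 2 := by
          rw [← Real.exp_nat_mul]; congr 1; push_cast; ring
        rw [h, Real.exp_add, hd2, hs2]
        nlinarith [sq_nonneg (Real.exp (D ω / 2) - Real.exp (S ω / 2))]
    _ = ENNReal.ofReal (1 / 2) * ∫⁻ ω, eexp (D ω) ∂P +
        ENNReal.ofReal (1 / 2) * ∫⁻ ω, eexp (S ω) ∂P := by
        rw [lintegral_add_left (by fun_prop), lintegral_const_mul _ (by fun_prop),
          lintegral_const_mul _ (by fun_prop)]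
    _ ≤ ENNReal.ofReal (1 / 2) * eexp (1536 * c ^ 2 * μ ^ 2 * ℓ) +
        ENNReal.ofReal (1 / 2) * eexp (1536 * c ^ 2 * μ ^ 2 * ℓ) := by gcongr
    _ = _ := by
        rw [← add_mul, ← ENNReal.ofReal_add (by norm_num) (by norm_num)]
        norm_num

/-- The Hanson-Wright inequality for the projection `Bᵀ B`. -/
theorem measureReal_abs_sum_sq_sub_le (hB : B * B.transpose = 1)
    (hm : ∀ i, Measurable (ζ i)) (hind : iIndepFun ζ P)
    (hsub : ∀ i s, ∫⁻ ω, eexp (s * ζ i ω) ∂P ≤ eexp (c * s ^ 2 / 2)) (hc : 1 ≤ c)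
    (hv : ∀ i, ∫ ω, ζ i ω ^ 2 ∂P = v) (hvc : v ≤ c) {t : ℝ} (ht : 0 < t) (ht1 : t ≤ 1) :
    P.real {ω | t * ℓ ≤ |∑ a, (∑ i, B a i * ζ i ω) ^ 2 - ℓ * v|} ≤
      2 * Real.exp (-(t ^ 2 / (6144 * c ^ 2) * ℓ)) := by
  have hc0 : 0 < c := by linarith
  -- The minimizer of the Chernoff exponent `1536 c² μ² ℓ - μ t ℓ`; `c ≥ 1` and `t ≤ 1` keep it in
  -- the admissible range.
  set μ := t / (3072 * c ^ 2) with hμ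
  have hμ0 : 0 < μ := by positivity
  have hμc : |μ| * (16 * c) ≤ 1 := by
    rw [abs_of_pos hμ0, hμ, div_mul_eq_mul_div, div_le_one (by positivity)]
    nlinarith
  set f : Ω → ℝ := fun ω => ∑ a, (∑ i, B a i * ζ i ω) ^ 2 - ℓ * v with hf
  have hfm : Measurable f := by fun_prop
  have key : ∀ ε : ℝ, |ε| = μ → P.real {ω | μ * (t * ℓ) ≤ ε * f ω} ≤
      Real.exp (-(t ^ 2 / (6144 * c ^ 2) * ℓ)) := by
    intro ε hε
    refine (measureReal_le_exp_of_lintegral_eexp_le (by fun_prop)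
      (lintegral_eexp_sum_sq_sub_le hB hm hind hsub hc0 hv hvc (μ := ε) ?_)).trans
      (le_of_eq ?_)
    · rw [hε, ← abs_of_pos hμ0]; exact hμc
    · congr 1
      rw [← sq_abs ε, hε, hμ]
      field_simp
      ring
  have hsub : {ω | t * ℓ ≤ |f ω|} ⊆
      {ω | μ * (t * ℓ) ≤ μ * f ω} ∪ {ω | μ * (t * ℓ) ≤ (-μ) * f ω} := by
    intro ω hω
    rcases le_abs.1 (show t * ℓ ≤ |f ω| from hω) with h | h
    · exact Or.inl (mul_le_mul_of_nonneg_left h hμ0.le)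
    · refine Or.inr ?_
      change μ * (t * ℓ) ≤ -μ * f ω
      nlinarith
  calc _ ≤ P.real ({ω | μ * (t * ℓ) ≤ μ * f ω} ∪ {ω | μ * (t * ℓ) ≤ (-μ) * f ω}) :=
        measureReal_mono hsub
    _ ≤ _ := measureReal_union_le _ _
    _ ≤ _ := by
      have h1 := key μ (abs_of_pos hμ0)
      have h2 := key (-μ) (by rw [abs_neg, abs_of_pos hμ0])
      linarith

end

/-! ### From tail bounds to moment generating functions; independence of rows. -/

theorem Real.exp_le_add_exp_sq (x : ℝ) : Real.exp x ≤ x + Real.exp (x ^ 2) := by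
  rcases le_or_gt |x| 1 with h | h
  · have := (abs_le.1 (Real.abs_exp_sub_one_sub_id_le h)).2
    linarith [Real.add_one_le_exp (x ^ 2)]
  · rcases lt_abs.1 h with h' | h'
    · have : Real.exp x ≤ Real.exp (x ^ 2) := Real.exp_le_exp.2 (by nlinarith)
      linarith
    · have h1 : Real.exp x ≤ 1 := Real.exp_le_one_iff.2 (by linarith)
      nlinarith [Real.add_one_le_exp (x ^ 2)]

/-- The chord bound of convexity. It turns a bounded mean of `exp y` into a mean of `exp (θ y)` that
is `1 + O(θ)`. -/
theorem Real.exp_mul_le_one_add {θ : ℝ} (h0 : 0 ≤ θ) (h1 : θ ≤ 1) (y : ℝ) :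
    Real.exp (θ * y) ≤ 1 + θ * (Real.exp y - 1) := by
  have := convexOn_exp.2 (Set.mem_univ 0) (Set.mem_univ y) (sub_nonneg.2 h1) h0 (by ring)
  simp only [smul_eq_mul, mul_zero, zero_add, Real.exp_zero] at this
  linarith

section

variable {Ω : Type*} [MeasurableSpace Ω] {P : Measure Ω} [IsProbabilityMeasure P]

/-- Layer-cake formula: the exponent `1/(2K)` makes the tail at level `t` at most `e t⁻²`,
integrable on `(1, ∞)` with integral `e`; levels up to 1 contribute at most 1. -/
theorem lintegral_eexp_sq_le_of_tail {X : Ω → ℝ} {K : ℝ} (hK : 0 < K) (hX : Measurable X)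
    (h : IsSubGaussian X K P) :
    ∫⁻ ω, eexp (1 / (2 * K) * X ω ^ 2) ∂P ≤ ENNReal.ofReal (1 + Real.exp 1) := by
  have h1 : ∫⁻ ω, eexp (1 / (2 * K) * X ω ^ 2) ∂P =
      ∫⁻ t in Set.Ioi (0 : ℝ), P {ω | t < Real.exp (1 / (2 * K) * X ω ^ 2)} :=
    lintegral_eq_lintegral_meas_lt P (Filter.Eventually.of_forall fun _ => Real.exp_nonneg _)
      (by fun_prop)
  have htail : ∀ t ∈ Set.Ioi (1 : ℝ), P {ω | t < Real.exp (1 / (2 * K) * X ω ^ 2)} ≤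
      ENNReal.ofReal (Real.exp 1 * t ^ (-2 : ℝ)) := by
    intro t ht
    have ht1 : (1 : ℝ) < t := ht
    have hlog : 0 ≤ Real.log t := Real.log_nonneg ht1.le
    have hsub : {ω | t < Real.exp (1 / (2 * K) * X ω ^ 2)} ⊆
        {ω | √(2 * K * Real.log t) < |X ω|} := by
      intro ω hω
      have h2 : Real.log t < 1 / (2 * K) * X ω ^ 2 :=
        (Real.log_lt_iff_lt_exp (by linarith)).2 hω
      refine Real.sqrt_lt' (lt_of_le_of_ne (abs_nonneg _) ?_) |>.2 ?_
      · intro h0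
        rw [← sq_abs, ← h0] at h2
        simp only [ne_eq, OfNat.ofNat_ne_zero, not_false_eq_true, zero_pow, mul_zero] at h2
        linarith
      · rw [sq_abs]
        have := mul_lt_mul_of_pos_left h2 (show 0 < 2 * K by positivity)
        field_simp at this ⊢
        linarith
    have h3 := h (√(2 * K * Real.log t)) (Real.sqrt_nonneg _)
    rw [Real.sq_sqrt (by positivity)] at h3
    have h4 : Real.exp (1 - 2 * K * Real.log t / K) = Real.exp 1 * t ^ (-2 : ℝ) := by
      rw [Real.rpow_def_of_pos (by linarith), ← Real.exp_add]
      congr 1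
      field_simp
      ring
    rw [h4] at h3
    refine (measure_mono hsub).trans ?_
    rw [← ENNReal.ofReal_toReal (measure_ne_top P _)]
    exact ENNReal.ofReal_le_ofReal h3
  have hU : Set.Ioi (0 : ℝ) = Set.Ioc 0 1 ∪ Set.Ioi 1 := (Set.Ioc_union_Ioi_eq_Ioi zero_le_one).symm
  rw [h1, hU]
  calc _ ≤ (∫⁻ t in Set.Ioc (0 : ℝ) 1, P {ω | t < Real.exp (1 / (2 * K) * X ω ^ 2)}) +
        ∫⁻ t in Set.Ioi (1 : ℝ), P {ω | t < Real.exp (1 / (2 * K) * X ω ^ 2)} :=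
        lintegral_union_le _ _ _
    _ ≤ (∫⁻ _t in Set.Ioc (0 : ℝ) 1, 1) +
        ∫⁻ t in Set.Ioi (1 : ℝ), ENNReal.ofReal (Real.exp 1 * t ^ (-2 : ℝ)) := by
        refine add_le_add (lintegral_mono fun t => prob_le_one) ?_
        exact setLIntegral_mono' measurableSet_Ioi htail
    _ = 1 + ENNReal.ofReal (Real.exp 1) := by
        congr 1
        · simp
        · rw [← ofReal_integral_eq_lintegral_ofReal
            ((integrableOn_Ioi_rpow_of_lt (by norm_num) one_pos).const_mul _), integral_const_mul,
            integral_Ioi_rpow_of_lt (by norm_num) one_pos]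
          · norm_num
          · refine (ae_restrict_iff' measurableSet_Ioi).2 (Filter.Eventually.of_forall fun t ht => ?_)
            have : (0 : ℝ) < t := one_pos.trans ht
            positivity
    _ = _ := by rw [ENNReal.ofReal_add zero_le_one (Real.exp_nonneg _), ENNReal.ofReal_one]

theorem integrable_exp_sq_of_tail {X : Ω → ℝ} {K : ℝ} (hK : 0 < K) (hX : Measurable X)
    (h : IsSubGaussian X K P) :
    Integrable (fun ω => Real.exp (1 / (2 * K) * X ω ^ 2)) P ∧
      ∫ ω, Real.exp (1 / (2 * K) * X ω ^ 2) ∂P ≤ 1 + Real.exp 1 := by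
  have hlog : ENNReal.ofReal (1 + Real.exp 1) = eexp (Real.log (1 + Real.exp 1)) := by
    rw [eexp, Real.exp_log (by positivity)]
  have := integrable_exp_of_lintegral_eexp_le (by fun_prop)
    ((lintegral_eexp_sq_le_of_tail hK hX h).trans_eq hlog)
  rwa [Real.exp_log (by positivity)] at this

theorem memLp_two_of_tail {X : Ω → ℝ} {K : ℝ} (hK : 0 < K) (hX : Measurable X)
    (h : IsSubGaussian X K P) : MemLp X 2 P := by
  rw [memLp_two_iff_integrable_sq (by fun_prop)]
  refine ((integrable_exp_sq_of_tail hK hX h).1.const_mul (2 * K)).mono' (by fun_prop)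
    (Filter.Eventually.of_forall fun ω => ?_)
  rw [Real.norm_of_nonneg (sq_nonneg _)]
  have h1 := Real.add_one_le_exp (1 / (2 * K) * X ω ^ 2)
  calc X ω ^ 2 = 2 * K * (1 / (2 * K) * X ω ^ 2) := by field_simp
    _ ≤ _ := mul_le_mul_of_nonneg_left (by linarith) (by positivity)

/-- For small `s`, `exp x ≤ x + exp (x²)` isolates a linear term of mean zero, and the chord bound
with `θ = 2Ks²` leaves `1 + 6Ks²`. For large `s`, `sX ≤ Ks² + X²/(4K)` suffices, the constant loss
being absorbed since `2Ks² > 1`. -/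
theorem lintegral_eexp_mul_le_of_tail {X : Ω → ℝ} {K : ℝ} (hK : 0 < K) (hX : Measurable X)
    (h : IsSubGaussian X K P) (h0 : ∫ ω, X ω ∂P = 0) (s : ℝ) :
    ∫⁻ ω, eexp (s * X ω) ∂P ≤ eexp (12 * K * s ^ 2 / 2) := by
  obtain ⟨hWi, hW⟩ := integrable_exp_sq_of_tail hK hX h
  have hXi : Integrable X P := (memLp_two_of_tail hK hX h).integrable one_le_two
  have he := Real.exp_one_lt_d9
  have he' := Real.add_one_le_exp (1 : ℝ)
  have main : ∀ g : Ω → ℝ, Integrable g P → (∀ ω, Real.exp (s * X ω) ≤ g ω) →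
      ∫ ω, g ω ∂P ≤ Real.exp (12 * K * s ^ 2 / 2) →
      ∫⁻ ω, eexp (s * X ω) ∂P ≤ eexp (12 * K * s ^ 2 / 2) := by
    intro g hg hle hint
    calc _ ≤ ∫⁻ ω, ENNReal.ofReal (g ω) ∂P :=
          lintegral_mono fun ω => ENNReal.ofReal_le_ofReal (hle ω)
      _ = ENNReal.ofReal (∫ ω, g ω ∂P) := (ofReal_integral_eq_lintegral_ofReal hg
          (Filter.Eventually.of_forall fun ω => (Real.exp_nonneg _).trans (hle ω))).symm
      _ ≤ _ := ENNReal.ofReal_le_ofReal hint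
  set W : Ω → ℝ := fun ω => Real.exp (1 / (2 * K) * X ω ^ 2) with hWdef
  have hi1 : Integrable (fun ω => W ω - 1) P := hWi.sub (integrable_const 1)
  have hi2 : ∀ r : ℝ, Integrable (fun ω => 1 + r * (W ω - 1)) P := fun r =>
    (integrable_const 1).add (hi1.const_mul r)
  have hint : ∀ r : ℝ, ∫ ω, (1 + r * (W ω - 1)) ∂P = 1 + r * (∫ ω, W ω ∂P - 1) := by
    intro r
    rw [integral_add (integrable_const 1) (hi1.const_mul r), integral_const_mul,
      integral_sub hWi (integrable_const 1)]
    simp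
  rcases le_or_gt (2 * K * s ^ 2) 1 with hs | hs
  · refine main (fun ω => s * X ω + (1 + 2 * K * s ^ 2 * (W ω - 1))) ?_ (fun ω => ?_) ?_
    · exact (hXi.const_mul s).add (hi2 _)
    · refine (Real.exp_le_add_exp_sq _).trans ?_
      have h1 := Real.exp_mul_le_one_add (show 0 ≤ 2 * K * s ^ 2 by positivity) hs
        (1 / (2 * K) * X ω ^ 2)
      have h2 : 2 * K * s ^ 2 * (1 / (2 * K) * X ω ^ 2) = (s * X ω) ^ 2 := by field_simp
      rw [h2] at h1
      linarith
    · rw [integral_add (hXi.const_mul s) (hi2 _), integral_const_mul, h0, hint]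
      have h3 : 2 * K * s ^ 2 * (∫ ω, W ω ∂P - 1) ≤ 2 * K * s ^ 2 * 3 :=
        mul_le_mul_of_nonneg_left (by linarith) (by positivity)
      linarith [Real.add_one_le_exp (12 * K * s ^ 2 / 2)]
  · refine main (fun ω => Real.exp (K * s ^ 2) * (1 + 1 / 2 * (W ω - 1))) ?_ (fun ω => ?_) ?_
    · exact (hi2 _).const_mul _
    · have h1 := Real.exp_mul_le_one_add (show (0 : ℝ) ≤ 1 / 2 by norm_num) (by norm_num)
        (1 / (2 * K) * X ω ^ 2)
      refine le_trans ?_ (mul_le_mul_of_nonneg_left h1 (Real.exp_nonneg _))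
      rw [← Real.exp_add]
      refine Real.exp_le_exp.2 ?_
      have h2 : K * s ^ 2 + 1 / 2 * (1 / (2 * K) * X ω ^ 2) - s * X ω =
          (2 * K * s - X ω) ^ 2 / (4 * K) := by field_simp; ring
      have h3 : 0 ≤ (2 * K * s - X ω) ^ 2 / (4 * K) := by positivity
      linarith
    · rw [integral_const_mul, hint]
      have h3 : 1 + 1 / 2 * (∫ ω, W ω ∂P - 1) ≤ Real.exp (3 / 2) := by
        linarith [Real.add_one_le_exp (3 / 2 : ℝ)]
      calc _ ≤ Real.exp (K * s ^ 2) * Real.exp (3 / 2) :=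
            mul_le_mul_of_nonneg_left h3 (Real.exp_nonneg _)
        _ ≤ _ := by
            rw [← Real.exp_add]
            exact Real.exp_le_exp.2 (by linarith)

/-- The rows of a family of independent random variables are independent. -/
theorem iIndepFun_rows {ι κ : Type*} [Fintype ι] [Fintype κ] {A : ι → κ → Ω → ℝ}
    (hm : ∀ i p, Measurable (A i p)) (h : iIndepFun (fun (q : ι × κ) ω => A q.1 q.2 ω) P) :
    iIndepFun (fun i ω p => A i p ω) P := by
  have hrow : ∀ i, P.map (fun ω p => A i p ω) = Measure.pi fun p => P.map (A i p) := fun i =>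
    (iIndepFun.precomp (g := fun p : κ => (i, p)) (fun _ _ h => (Prod.ext_iff.1 h).2)
      h).map_fun_eq_pi_map fun p => (hm i p).aemeasurable
  have : ∀ i p, IsProbabilityMeasure (P.map (A i p)) := fun i p =>
    Measure.isProbabilityMeasure_map (hm i p).aemeasurable
  rw [iIndepFun_iff_map_fun_eq_infinitePi_map fun i => by fun_prop]
  simp only [hrow, ← Measure.infinitePi_eq_pi]
  rw [← Measure.infinitePi_map_curry fun i p => P.map (A i p),
    ← (iIndepFun_iff_map_fun_eq_infinitePi_map (fun q : ι × κ => hm q.1 q.2)).1 h,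
    Measure.map_map (by fun_prop) (by fun_prop)]
  rfl

end

/-! ### Nets and norming sets in finite-dimensional normed spaces. -/

section Net

variable (E : Type*) [NormedAddCommGroup E] [NormedSpace ℝ E] [FiniteDimensional ℝ E]

/-- A `1/2`-net of the unit ball with at most `5 ^ d` points. -/
theorem exists_finset_half_net : ∃ N : Finset E, N.card ≤ 5 ^ Module.finrank ℝ E ∧
    (∀ n ∈ N, ‖n‖ ≤ 1) ∧ ∀ u : E, ‖u‖ ≤ 1 → ∃ n ∈ N, ‖u - n‖ ≤ 1 / 2 := by
  classical
  let sep : Finset E → Prop := fun s =>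
    (∀ c ∈ s, ‖c‖ ≤ 2) ∧ ∀ c ∈ s, ∀ d ∈ s, c ≠ d → 1 ≤ ‖c - d‖
  -- A 1-separated subset of the ball of radius 2 with the most points is a 1-net of that ball;
  -- halving it gives the net sought.
  let C : Set ℕ := {n | ∃ s, sep s ∧ s.card = n}
  have hbdd : ∀ n ∈ C, n ≤ 5 ^ Module.finrank ℝ E := by
    rintro _ ⟨s, hs, rfl⟩
    exact Besicovitch.card_le_of_separated s hs.1 hs.2
  have hCb : BddAbove C := ⟨_, hbdd⟩
  have hC : C.Nonempty := ⟨0, ∅, by simp [sep]⟩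
  obtain ⟨s, hs, hcard⟩ := Nat.sSup_mem hC hCb
  refine ⟨s.image fun c => (1 / 2 : ℝ) • c, ?_, ?_, ?_⟩
  · exact Finset.card_image_le.trans (Besicovitch.card_le_of_separated s hs.1 hs.2)
  · intro n hn
    obtain ⟨c, hc, rfl⟩ := Finset.mem_image.1 hn
    rw [norm_smul, Real.norm_of_nonneg (by norm_num)]
    linarith [hs.1 c hc]
  · intro u hu
    have hu2 : ‖(2 : ℝ) • u‖ ≤ 2 := by
      rw [norm_smul, Real.norm_of_nonneg (by norm_num)]; linarith
    obtain ⟨c, hc, hcu⟩ : ∃ c ∈ s, ‖(2 : ℝ) • u - c‖ ≤ 1 := by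
      by_contra! hfar
      have hnot : (2 : ℝ) • u ∉ s := fun hmem => by
        have := hfar _ hmem
        simp only [sub_self, norm_zero] at this
        linarith
      have hins : sep (insert ((2 : ℝ) • u) s) := by
        refine ⟨fun c hc => ?_, fun c hc d hd hcd => ?_⟩
        · rcases Finset.mem_insert.1 hc with rfl | hc
          · exact hu2
          · exact hs.1 c hc
        · rcases Finset.mem_insert.1 hc with rfl | hc <;> rcases Finset.mem_insert.1 hd with rfl | hd
          · exact absurd rfl hcd
          · exact (hfar d hd).le
          · rw [norm_sub_rev]; exact (hfar c hc).le
          · exact hs.2 c hc d hd hcd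
      have := le_csSup hCb ⟨_, hins, rfl⟩
      rw [Finset.card_insert_of_notMem hnot, hcard] at this
      omega
    refine ⟨_, Finset.mem_image_of_mem _ hc, ?_⟩
    have h : u - (1 / 2 : ℝ) • c = (1 / 2 : ℝ) • ((2 : ℝ) • u - c) := by
      rw [smul_sub, smul_smul]; norm_num
    rw [h, norm_smul, Real.norm_of_nonneg (by norm_num)]
    linarith

/-- At most `5 ^ d` points of the unit ball determine the norm of every linear functional up to a
factor two. -/
theorem exists_finset_norming : ∃ N : Finset E, N.card ≤ 5 ^ Module.finrank ℝ E ∧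
    (∀ n ∈ N, ‖n‖ ≤ 1) ∧ ∀ (L : E →ₗ[ℝ] ℝ) (a : ℝ), (∀ n ∈ N, |L n| ≤ a) →
      ∀ u, |L u| ≤ 2 * a * ‖u‖ := by
  obtain ⟨N, hcard, hN, hnet⟩ := exists_finset_half_net E
  refine ⟨N, hcard, hN, fun L a hL => ?_⟩
  obtain ⟨n₀, hn₀, -⟩ := hnet 0 (by simp)
  have ha : 0 ≤ a := (abs_nonneg _).trans (hL n₀ hn₀)
  let f := LinearMap.toContinuousLinearMap L
  -- Approximation by the net costs half the norm of `f`, which is absorbed on the left.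
  have hf : ‖f‖ ≤ a + ‖f‖ / 2 := by
    refine ContinuousLinearMap.opNorm_le_of_unit_norm (by positivity) fun u hu => ?_
    obtain ⟨n, hn, hun⟩ := hnet u hu.le
    have h1 : f u = f n + f (u - n) := by rw [map_sub]; ring
    rw [h1]
    refine (norm_add_le _ _).trans (add_le_add (hL n hn) ((f.le_opNorm _).trans ?_))
    linarith [mul_le_mul_of_nonneg_left hun (norm_nonneg f)]
  intro u
  calc |L u| ≤ ‖f‖ * ‖u‖ := f.le_opNorm u
    _ ≤ 2 * a * ‖u‖ := by
      refine mul_le_mul_of_nonneg_right (by linarith) (norm_nonneg u)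

end Net

/-! ### Factorization of low-rank matrices and passage from the net to all of them. -/

section LowRank

variable {n₁ n₂ k ℓ : ℕ}

/-- The linear map sending a matrix to its entries, as a vector of a Euclidean space. -/
noncomputable def vecEuclidean (n₁ n₂ : ℕ) :
    Matrix (Fin n₁) (Fin n₂) ℝ →ₗ[ℝ] EuclideanSpace ℝ (Fin n₂ × Fin n₁) where
  toFun X := WithLp.toLp 2 (Matrix.vec X)
  map_add' _ _ := rfl
  map_smul' _ _ := rfl

theorem norm_vecEuclidean_sq (X : Matrix (Fin n₁) (Fin n₂) ℝ) :
    ‖vecEuclidean n₁ n₂ X‖ ^ 2 = ∑ p : Fin n₂ × Fin n₁, X p.2 p.1 ^ 2 := by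
  rw [EuclideanSpace.norm_sq_eq]
  simp only [Real.norm_eq_abs, sq_abs]
  rfl

open scoped Matrix.Norms.Frobenius in
theorem frobenius_norm_eq_norm_vecEuclidean (X : Matrix (Fin n₁) (Fin n₂) ℝ) :
    ‖X‖ ^ 2 = ‖vecEuclidean n₁ n₂ X‖ ^ 2 := by
  rw [norm_vecEuclidean_sq, Matrix.frobenius_norm_def, ← Real.sqrt_eq_rpow, Real.sq_sqrt]
  · rw [Fintype.sum_prod_type, Finset.sum_comm]
    simp
  · positivity

/-- The left factors: linear maps `ℝ^k → ℝ^{n₁}` with the operator norm. -/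
abbrev LeftFactor (n₁ k : ℕ) := EuclideanSpace ℝ (Fin k) →L[ℝ] EuclideanSpace ℝ (Fin n₁)

/-- The right factors: `n₂` columns in `ℝ^k`, with the Frobenius norm. -/
abbrev RightFactor (n₂ k : ℕ) := PiLp 2 fun _ : Fin n₂ => EuclideanSpace ℝ (Fin k)

/-- The product of a left and a right factor. -/
noncomputable def factorMul (n₁ n₂ k : ℕ) :
    LeftFactor n₁ k →ₗ[ℝ] RightFactor n₂ k →ₗ[ℝ] Matrix (Fin n₁) (Fin n₂) ℝ :=
  LinearMap.mk₂ ℝ (fun U W => Matrix.of fun i j => U (W j) i)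
    (fun _ _ _ => by ext; simp) (fun _ _ _ => by ext; simp)
    (fun _ _ _ => by ext; simp) (fun _ _ _ => by ext; simp)

theorem factorMul_apply (U : LeftFactor n₁ k) (W : RightFactor n₂ k) (i : Fin n₁) (j : Fin n₂) :
    factorMul n₁ n₂ k U W i j = U (W j) i := rfl

theorem norm_vecEuclidean_factorMul_le (U : LeftFactor n₁ k) (W : RightFactor n₂ k) :
    ‖vecEuclidean n₁ n₂ (factorMul n₁ n₂ k U W)‖ ≤ ‖U‖ * ‖W‖ := by
  refine abs_le_of_sq_le_sq' ?_ (by positivity) |>.2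
  rw [norm_vecEuclidean_sq, Fintype.sum_prod_type, mul_pow, PiLp.norm_sq_eq_of_L2, Finset.mul_sum]
  refine Finset.sum_le_sum fun j _ => ?_
  calc _ = ‖U (W j)‖ ^ 2 := by
        rw [EuclideanSpace.norm_sq_eq]; simp [factorMul_apply]
    _ ≤ (‖U‖ * ‖W j‖) ^ 2 := by gcongr; exact U.le_opNorm _
    _ = _ := mul_pow _ _ _

theorem finrank_leftFactor : Module.finrank ℝ (LeftFactor n₁ k) = k * n₁ := by
  rw [← LinearEquiv.finrank_eq (LinearMap.toContinuousLinearMap (𝕜 := ℝ)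
    (E := EuclideanSpace ℝ (Fin k)) (F' := EuclideanSpace ℝ (Fin n₁)))]
  simp [Module.finrank_linearMap]

theorem finrank_rightFactor : Module.finrank ℝ (RightFactor n₂ k) = k * n₂ := by
  rw [LinearEquiv.finrank_eq (WithLp.linearEquiv 2 ℝ (Fin n₂ → EuclideanSpace ℝ (Fin k))),
    Module.finrank_pi_fintype]
  simp [mul_comm]

theorem exists_linearIsometry_euclideanSpace {V : Type*} [NormedAddCommGroup V]
    [InnerProductSpace ℝ V] [FiniteDimensional ℝ V] (h : Module.finrank ℝ V ≤ k) :
    Nonempty (V →ₗᵢ[ℝ] EuclideanSpace ℝ (Fin k)) := by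
  let b := stdOrthonormalBasis ℝ V
  let f : V →ₗ[ℝ] EuclideanSpace ℝ (Fin k) := b.toBasis.constr ℝ
    fun a => EuclideanSpace.basisFun (Fin k) ℝ (Fin.castLE h a)
  have hf : f ∘ b.toBasis = EuclideanSpace.basisFun (Fin k) ℝ ∘ Fin.castLE h := by
    ext1 a
    simp only [Function.comp_apply, f, Module.Basis.constr_basis]
  exact ⟨f.isometryOfOrthonormal (v := b.toBasis) (by simp) (by
    rw [hf]
    exact (EuclideanSpace.basisFun (Fin k) ℝ).orthonormal.comp _ (Fin.castLE_injective h))⟩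

/-- The column space embeds isometrically in `ℝ^k` by some `φ`. Take for `W` the images of the
columns and for `U` the adjoint of `φ`; `φ* φ = 1` recovers `X`. -/
theorem exists_eq_factorMul_of_rank_le {X : Matrix (Fin n₁) (Fin n₂) ℝ} (h : X.rank ≤ k) :
    ∃ (U : LeftFactor n₁ k) (W : RightFactor n₂ k), X = factorMul n₁ n₂ k U W ∧ ‖U‖ ≤ 1 ∧
      ‖W‖ = ‖vecEuclidean n₁ n₂ X‖ := by
  let R := LinearMap.range (Matrix.toEuclideanLin X)
  have hR : Module.finrank ℝ R = X.rank := by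
    rw [Matrix.rank_eq_finrank_range_toLin X (PiLp.basisFun 2 ℝ (Fin n₁))
      (PiLp.basisFun 2 ℝ (Fin n₂)), ← Matrix.toLpLin_eq_toLin]
  obtain ⟨φ⟩ := exists_linearIsometry_euclideanSpace (V := R) (hR.trans_le h)
  let col : Fin n₂ → R := fun j =>
    ⟨Matrix.toEuclideanLin X (EuclideanSpace.single j 1), LinearMap.mem_range_self _ _⟩
  have hcol : ∀ i j, (col j : EuclideanSpace ℝ (Fin n₁)) i = X i j := by
    intro i j
    simp [col, Matrix.toEuclideanLin]
  have hadj : ∀ v, ContinuousLinearMap.adjoint φ.toContinuousLinearMap (φ v) = v := by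
    intro v
    refine ext_inner_right ℝ fun w => ?_
    rw [ContinuousLinearMap.adjoint_inner_left]
    exact φ.inner_map_map v w
  refine ⟨R.subtypeL ∘L ContinuousLinearMap.adjoint φ.toContinuousLinearMap,
    WithLp.toLp 2 fun j => φ (col j), ?_, ?_, ?_⟩
  · ext i j
    rw [factorMul_apply]
    simp [hadj, hcol]
  · refine (ContinuousLinearMap.opNorm_comp_le _ _).trans ?_
    refine mul_le_one₀ R.norm_subtypeL_le (ContinuousLinearMap.opNorm_nonneg _) ?_
    rw [LinearIsometryEquiv.norm_map]
    exact φ.norm_toContinuousLinearMap_le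
  · refine (sq_eq_sq₀ (norm_nonneg _) (norm_nonneg _)).1 ?_
    rw [norm_vecEuclidean_sq, Fintype.sum_prod_type, PiLp.norm_sq_eq_of_L2]
    refine Finset.sum_congr rfl fun j _ => ?_
    simp only [LinearIsometry.norm_map]
    rw [Submodule.coe_norm, EuclideanSpace.norm_sq_eq]
    simp [hcol]

/-- The deviation `‖T X‖² - ‖X‖²` of a linear map from an isometry. -/
noncomputable def isometryDefect
    (T : Matrix (Fin n₁) (Fin n₂) ℝ →ₗ[ℝ] EuclideanSpace ℝ (Fin ℓ))
    (X : Matrix (Fin n₁) (Fin n₂) ℝ) : ℝ :=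
  ‖T X‖ ^ 2 - ‖vecEuclidean n₁ n₂ X‖ ^ 2

/-- The symmetric bilinear form of `isometryDefect`. -/
noncomputable def defectForm (T : Matrix (Fin n₁) (Fin n₂) ℝ →ₗ[ℝ] EuclideanSpace ℝ (Fin ℓ)) :
    Matrix (Fin n₁) (Fin n₂) ℝ →ₗ[ℝ] Matrix (Fin n₁) (Fin n₂) ℝ →ₗ[ℝ] ℝ :=
  (innerₗ _).compl₁₂ T T - (innerₗ _).compl₁₂ (vecEuclidean n₁ n₂) (vecEuclidean n₁ n₂)

theorem defectForm_apply (T : Matrix (Fin n₁) (Fin n₂) ℝ →ₗ[ℝ] EuclideanSpace ℝ (Fin ℓ))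
    (Y Z : Matrix (Fin n₁) (Fin n₂) ℝ) : defectForm T Y Z =
      inner ℝ (T Y) (T Z) - inner ℝ (vecEuclidean n₁ n₂ Y) (vecEuclidean n₁ n₂ Z) := rfl

theorem defectForm_self (T : Matrix (Fin n₁) (Fin n₂) ℝ →ₗ[ℝ] EuclideanSpace ℝ (Fin ℓ))
    (X : Matrix (Fin n₁) (Fin n₂) ℝ) : defectForm T X X = isometryDefect T X := by
  rw [defectForm_apply, real_inner_self_eq_norm_sq, real_inner_self_eq_norm_sq, isometryDefect]

theorem defectForm_eq_polarization
    (T : Matrix (Fin n₁) (Fin n₂) ℝ →ₗ[ℝ] EuclideanSpace ℝ (Fin ℓ))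
    (Y Z : Matrix (Fin n₁) (Fin n₂) ℝ) :
    defectForm T Y Z = (isometryDefect T (Y + Z) - isometryDefect T (Y - Z)) / 4 := by
  simp only [defectForm_apply, isometryDefect, map_add, map_sub, norm_add_sq_real,
    norm_sub_sq_real]
  ring

/-- Almost isometry on sums and differences of products of net points extends to all matrices of
low rank. -/
theorem abs_isometryDefect_le_of_norming {N₁ : Finset (LeftFactor n₁ k)}
    {N₂ : Finset (RightFactor n₂ k)}
    (hN₁ : ∀ (L : LeftFactor n₁ k →ₗ[ℝ] ℝ) (a : ℝ), (∀ n ∈ N₁, |L n| ≤ a) →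
      ∀ u, |L u| ≤ 2 * a * ‖u‖)
    (hN₂ : ∀ (L : RightFactor n₂ k →ₗ[ℝ] ℝ) (a : ℝ), (∀ n ∈ N₂, |L n| ≤ a) →
      ∀ u, |L u| ≤ 2 * a * ‖u‖)
    {T : Matrix (Fin n₁) (Fin n₂) ℝ →ₗ[ℝ] EuclideanSpace ℝ (Fin ℓ)} {t : ℝ} (ht : 0 ≤ t)
    (hadd : ∀ U ∈ N₁, ∀ W ∈ N₂, ∀ U' ∈ N₁, ∀ W' ∈ N₂,
      |isometryDefect T (factorMul n₁ n₂ k U W + factorMul n₁ n₂ k U' W')| ≤ t)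
    (hsub : ∀ U ∈ N₁, ∀ W ∈ N₂, ∀ U' ∈ N₁, ∀ W' ∈ N₂,
      |isometryDefect T (factorMul n₁ n₂ k U W - factorMul n₁ n₂ k U' W')| ≤ t)
    {X : Matrix (Fin n₁) (Fin n₂) ℝ} (hX : X.rank ≤ k) :
    |isometryDefect T X| ≤ 8 * t * ‖vecEuclidean n₁ n₂ X‖ ^ 2 := by
  let μ := factorMul n₁ n₂ k
  have h0 : ∀ U ∈ N₁, ∀ W ∈ N₂, ∀ U' ∈ N₁, ∀ W' ∈ N₂,
      |defectForm T (μ U W) (μ U' W')| ≤ t / 2 := by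
    intro U hU W hW U' hU' W' hW'
    rw [defectForm_eq_polarization, abs_le]
    have h1 := abs_le.1 (hadd U hU W hW U' hU' W' hW')
    have h2 := abs_le.1 (hsub U hU W hW U' hU' W' hW')
    constructor <;> linarith
  -- The four factors are freed from the norming sets one at a time, each at the cost of a factor 2:
  -- `16 · t/2 = 8t`.
  have h1 : ∀ U ∈ N₁, ∀ W ∈ N₂, ∀ U' ∈ N₁, ∀ W',
      |defectForm T (μ U W) (μ U' W')| ≤ 2 * (t / 2) * ‖W'‖ :=
    fun U hU W hW U' hU' => hN₂ (defectForm T (μ U W) ∘ₗ μ U') _ (h0 U hU W hW U' hU')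
  have h2 : ∀ U ∈ N₁, ∀ W ∈ N₂, ∀ U' W',
      |defectForm T (μ U W) (μ U' W')| ≤ 2 * (2 * (t / 2) * ‖W'‖) * ‖U'‖ :=
    fun U hU W hW U' W' => hN₁ (defectForm T (μ U W) ∘ₗ μ.flip W') _
      (fun U' hU' => h1 U hU W hW U' hU' W') U'
  have h3 : ∀ U ∈ N₁, ∀ W U' W',
      |defectForm T (μ U W) (μ U' W')| ≤ 2 * (2 * (2 * (t / 2) * ‖W'‖) * ‖U'‖) * ‖W‖ :=
    fun U hU W U' W' => hN₂ ((defectForm T).flip (μ U' W') ∘ₗ μ U) _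
      (fun W hW => h2 U hU W hW U' W') W
  have h4 : ∀ U W U' W',
      |defectForm T (μ U W) (μ U' W')| ≤ 2 * (2 * (2 * (2 * (t / 2) * ‖W'‖) * ‖U'‖) * ‖W‖) * ‖U‖ :=
    fun U W U' W' => hN₁ ((defectForm T).flip (μ U' W') ∘ₗ μ.flip W) _
      (fun U hU => h3 U hU W U' W') U
  obtain ⟨U, W, rfl, hU, hW⟩ := exists_eq_factorMul_of_rank_le hX
  rw [← defectForm_self, ← hW]
  refine (h4 U W U W).trans ?_
  calc _ = 8 * t * ‖W‖ ^ 2 * (‖U‖ * ‖U‖) := by ring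
    _ ≤ 8 * t * ‖W‖ ^ 2 * 1 := by
      gcongr
      exact mul_le_one₀ hU (norm_nonneg _) hU
    _ = _ := mul_one _

end LowRank

/-! ### Concentration for one matrix, and the union bound. -/

section RandomMap

variable {Ω : Type*} [MeasurableSpace Ω] {P : Measure Ω}
  {m n₁ n₂ k ℓ : ℕ} {M : Ω → Matrix (Fin n₁) (Fin n₂) ℝ →ₗ[ℝ] EuclideanSpace ℝ (Fin m)} {K : ℝ}

theorem apply_eq_sum_operatorMatrix
    (M : Matrix (Fin n₁) (Fin n₂) ℝ →ₗ[ℝ] EuclideanSpace ℝ (Fin m))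
    (X : Matrix (Fin n₁) (Fin n₂) ℝ) (i : Fin m) :
    M X i = ∑ p, X p.2 p.1 * operatorMatrix M i p := by
  conv_lhs => rw [operatorMatrix_mulVec_vec M X]
  simp [Matrix.mulVec, dotProduct, Matrix.vec, mul_comm]

theorem IsSubGaussianMap.measurable_apply (h : IsSubGaussianMap M K P)
    (X : Matrix (Fin n₁) (Fin n₂) ℝ) (i : Fin m) : Measurable fun ω => M ω X i := by
  simp only [apply_eq_sum_operatorMatrix]
  have := h.measurable
  fun_prop

theorem IsSubGaussianMap.iIndepFun_row (h : IsSubGaussianMap M K P) (i : Fin m) :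
    iIndepFun (fun p ω => operatorMatrix (M ω) i p) P :=
  h.indep.precomp (g := fun p => (i, p)) fun _ _ hp => (Prod.ext_iff.1 hp).2

variable [IsProbabilityMeasure P]

theorem IsSubGaussianMap.iIndepFun_apply (h : IsSubGaussianMap M K P)
    (X : Matrix (Fin n₁) (Fin n₂) ℝ) : iIndepFun (fun i ω => M ω X i) P := by
  simp only [apply_eq_sum_operatorMatrix]
  exact (iIndepFun_rows (A := fun i p ω => operatorMatrix (M ω) i p) h.measurable h.indep).comp
    (fun _ a => ∑ p, X p.2 p.1 * a p) fun _ => by fun_prop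

theorem IsSubGaussianMap.lintegral_eexp_apply_le (h : IsSubGaussianMap M K P) (hK : 0 < K)
    {X : Matrix (Fin n₁) (Fin n₂) ℝ} {r : ℝ} (hX : ‖vecEuclidean n₁ n₂ X‖ ^ 2 ≤ r)
    (i : Fin m) (s : ℝ) :
    ∫⁻ ω, eexp (s * M ω X i) ∂P ≤ eexp (12 * K * r * s ^ 2 / 2) := by
  simp only [apply_eq_sum_operatorMatrix, Finset.mul_sum, ← mul_assoc]
  refine (lintegral_eexp_linear_le (h.measurable i) (h.iIndepFun_row i)
    (fun p => lintegral_eexp_mul_le_of_tail hK (h.measurable i p) (h.subGaussian i p)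
      (h.mean_zero i p)) Finset.univ fun p => s * X p.2 p.1).trans (eexp_le_eexp ?_)
  rw [norm_vecEuclidean_sq] at hX
  simp only [mul_pow, ← Finset.mul_sum]
  calc _ = 12 * K / 2 * s ^ 2 * ∑ p : Fin n₂ × Fin n₁, X p.2 p.1 ^ 2 := by ring
    _ ≤ 12 * K / 2 * s ^ 2 * r := by gcongr
    _ = _ := by ring

theorem IsSubGaussianMap.integral_apply_sq (h : IsSubGaussianMap M K P) (hK : 0 < K)
    (X : Matrix (Fin n₁) (Fin n₂) ℝ) (i : Fin m) :
    ∫ ω, M ω X i ^ 2 ∂P = ‖vecEuclidean n₁ n₂ X‖ ^ 2 := by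
  have hL : ∀ p, MemLp (fun ω => X p.2 p.1 * operatorMatrix (M ω) i p) 2 P := fun p =>
    (memLp_two_of_tail hK (h.measurable i p) (h.subGaussian i p)).const_mul _
  have hmean : ∫ ω, M ω X i ∂P = 0 := by
    simp only [apply_eq_sum_operatorMatrix]
    rw [integral_finsetSum _ fun p _ => (hL p).integrable one_le_two]
    simp [integral_const_mul, h.mean_zero]
  rw [← variance_of_integral_eq_zero (h.measurable_apply X i).aemeasurable hmean]
  have hsum : (fun ω => M ω X i) = ∑ p, fun ω => X p.2 p.1 * operatorMatrix (M ω) i p := by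
    ext ω
    rw [apply_eq_sum_operatorMatrix, Finset.sum_apply]
  rw [hsum, IndepFun.variance_sum (fun p _ => hL p), norm_vecEuclidean_sq]
  · refine Finset.sum_congr rfl fun p _ => ?_
    rw [variance_const_mul, h.unit_variance, mul_one]
  · intro p _ q _ hpq
    exact ((h.iIndepFun_row i).indepFun hpq).comp (measurable_const_mul _)
      (measurable_const_mul _)

/-- The operator `ℓ^{-1/2} P_ℓ Vᵀ M`. -/
noncomputable def subsampled (hℓm : ℓ ≤ m) (V : Matrix (Fin m) (Fin m) ℝ)
    (M : Matrix (Fin n₁) (Fin n₂) ℝ →ₗ[ℝ] EuclideanSpace ℝ (Fin m)) :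
    Matrix (Fin n₁) (Fin n₂) ℝ →ₗ[ℝ] EuclideanSpace ℝ (Fin ℓ) :=
  (1 / Real.sqrt (ℓ : ℝ)) • (firstCoords hℓm ∘ₗ Matrix.toEuclideanLin V.conjTranspose ∘ₗ M)

/-- The first `ℓ` rows of `Vᵀ`. -/
def firstRows (hℓm : ℓ ≤ m) (V : Matrix (Fin m) (Fin m) ℝ) : Matrix (Fin ℓ) (Fin m) ℝ :=
  V.conjTranspose.submatrix (Fin.castLE hℓm) id

theorem firstRows_mul_transpose (hℓm : ℓ ≤ m) {V : Matrix (Fin m) (Fin m) ℝ}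
    (hV : V ∈ Matrix.unitaryGroup (Fin m) ℝ) :
    firstRows hℓm V * (firstRows hℓm V).transpose = 1 := by
  have h : V.conjTranspose * V = 1 := Matrix.mem_unitaryGroup_iff'.1 hV
  ext a b
  have hab := congrFun (congrFun h (Fin.castLE hℓm a)) (Fin.castLE hℓm b)
  simp only [Matrix.mul_apply, Matrix.one_apply, Matrix.conjTranspose_apply, firstRows,
    Matrix.transpose_apply, Matrix.submatrix_apply, star_trivial, id] at hab ⊢
  rw [hab]
  simp [Fin.ext_iff]

theorem norm_subsampled_sq (hℓm : ℓ ≤ m) (V : Matrix (Fin m) (Fin m) ℝ)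
    (M : Matrix (Fin n₁) (Fin n₂) ℝ →ₗ[ℝ] EuclideanSpace ℝ (Fin m))
    (X : Matrix (Fin n₁) (Fin n₂) ℝ) :
    ‖subsampled hℓm V M X‖ ^ 2 = (∑ a, (∑ i, firstRows hℓm V a i * M X i) ^ 2) / ℓ := by
  rw [subsampled, LinearMap.smul_apply, norm_smul, mul_pow, EuclideanSpace.norm_sq_eq,
    Real.norm_eq_abs, sq_abs, div_pow, Real.sq_sqrt (Nat.cast_nonneg ℓ), one_pow,
    div_mul_eq_mul_div, one_mul]
  simp only [Real.norm_eq_abs, sq_abs]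
  rfl

/-- Norm 2 allows for sums and differences of two products from the unit ball. The coordinates of `M
X` then have subgaussian constant `12K · 4 = 48K`; adding 4 ensures that `c ≥ 1` and that `c`
dominates the variance. -/
theorem IsSubGaussianMap.measureReal_isometryDefect_le (h : IsSubGaussianMap M K P) (hK : 0 < K)
    (hℓm : ℓ ≤ m) (hℓ : 0 < ℓ) {V : Matrix (Fin m) (Fin m) ℝ}
    (hV : V ∈ Matrix.unitaryGroup (Fin m) ℝ) {X : Matrix (Fin n₁) (Fin n₂) ℝ}
    (hX : ‖vecEuclidean n₁ n₂ X‖ ≤ 2) {t : ℝ} (ht : 0 < t) (ht1 : t ≤ 1) :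
    P.real {ω | t < |isometryDefect (subsampled hℓm V (M ω)) X|} ≤
      2 * Real.exp (-(t ^ 2 / (6144 * (48 * K + 4) ^ 2) * ℓ)) := by
  have hX4 : ‖vecEuclidean n₁ n₂ X‖ ^ 2 ≤ 4 := by nlinarith [norm_nonneg (vecEuclidean n₁ n₂ X)]
  have hℓ0 : (0 : ℝ) < ℓ := Nat.cast_pos.2 hℓ
  refine le_trans (measureReal_mono fun ω hω => ?_) (measureReal_abs_sum_sq_sub_le
    (firstRows_mul_transpose hℓm hV) (h.measurable_apply X) (h.iIndepFun_apply X)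
    (c := 48 * K + 4) (fun i s => (h.lintegral_eexp_apply_le hK hX4 i s).trans
      (eexp_le_eexp ?_)) (by linarith) (h.integral_apply_sq hK X) (by linarith) ht ht1)
  · have hω' : t < |isometryDefect (subsampled hℓm V (M ω)) X| := hω
    rw [isometryDefect, norm_subsampled_sq] at hω'
    change t * ℓ ≤ |_|
    have hrw : ∀ x y : ℝ, x - ℓ * y = (x / ℓ - y) * ℓ := by
      intro x y; field_simp
    rw [hrw, abs_mul, abs_of_pos hℓ0]
    exact mul_le_mul_of_nonneg_right hω'.le hℓ0.le
  · nlinarith [sq_nonneg s]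

/-- The union bound over the net. -/
theorem IsSubGaussianMap.measureReal_not_matrixRIP_le (h : IsSubGaussianMap M K P) (hK : 0 < K)
    (hℓm : ℓ ≤ m) (hℓ : 0 < ℓ) {V : Matrix (Fin m) (Fin m) ℝ}
    (hV : V ∈ Matrix.unitaryGroup (Fin m) ℝ) (k : ℕ) {δ : ℝ} (hδ : 0 < δ) (hδ1 : δ ≤ 1) :
    P.real {ω | ¬ MatrixRIP k δ (subsampled hℓm V (M ω))} ≤
      25 ^ (k * (n₁ + n₂)) * (4 * Real.exp (-((δ / 8) ^ 2 / (6144 * (48 * K + 4) ^ 2) * ℓ))) := by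
  obtain ⟨N₁, hc₁, hb₁, hN₁⟩ := exists_finset_norming (LeftFactor n₁ k)
  obtain ⟨N₂, hc₂, hb₂, hN₂⟩ := exists_finset_norming (RightFactor n₂ k)
  rw [finrank_leftFactor] at hc₁
  rw [finrank_rightFactor] at hc₂
  set ε := Real.exp (-((δ / 8) ^ 2 / (6144 * (48 * K + 4) ^ 2) * ℓ)) with hε
  let μ := factorMul n₁ n₂ k
  let T := fun ω => subsampled hℓm V (M ω)
  let N := (N₁ ×ˢ N₂) ×ˢ (N₁ ×ˢ N₂)
  -- The level `δ / 8` offsets the factor 8 lost in the passage from the net to all matrices.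
  let bad (X : Matrix (Fin n₁) (Fin n₂) ℝ) : Set Ω := {ω | δ / 8 < |isometryDefect (T ω) X|}
  have hnorm : ∀ U ∈ N₁, ∀ W ∈ N₂, ‖vecEuclidean n₁ n₂ (μ U W)‖ ≤ 1 := fun U hU W hW =>
    (norm_vecEuclidean_factorMul_le U W).trans
      (mul_le_one₀ (hb₁ U hU) (norm_nonneg _) (hb₂ W hW))
  have hbad : ∀ X, ‖vecEuclidean n₁ n₂ X‖ ≤ 2 → P.real (bad X) ≤ 2 * ε := fun X hX =>
    h.measureReal_isometryDefect_le hK hℓm hℓ hV hX (by positivity) (by linarith)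
  have hcover : {ω | ¬ MatrixRIP k δ (T ω)} ⊆ ⋃ q ∈ N,
      (bad (μ q.1.1 q.1.2 + μ q.2.1 q.2.2) ∪ bad (μ q.1.1 q.1.2 - μ q.2.1 q.2.2)) := by
    intro ω hω
    by_contra hnot
    simp only [Set.mem_iUnion, not_exists, Set.mem_union, not_or] at hnot
    refine hω fun X hX => ?_
    have hgood := abs_isometryDefect_le_of_norming hN₁ hN₂ (T := T ω) (t := δ / 8) (by positivity)
      (fun U hU W hW U' hU' W' hW' => not_lt.1 (hnot ((U, W), (U', W'))
        (by simp [N, hU, hW, hU', hW'])).1)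
      (fun U hU W hW U' hU' W' hW' => not_lt.1 (hnot ((U, W), (U', W'))
        (by simp [N, hU, hW, hU', hW'])).2) hX
    rw [frobenius_norm_eq_norm_vecEuclidean]
    have := abs_le.1 hgood
    rw [isometryDefect] at this
    constructor <;> linarith
  have hcard : (N.card : ℝ) ≤ 25 ^ (k * (n₁ + n₂)) := by
    have h1 : N.card ≤ (5 ^ (k * n₁) * 5 ^ (k * n₂)) * (5 ^ (k * n₁) * 5 ^ (k * n₂)) := by
      simp only [N, Finset.card_product]
      gcongr
    calc (N.card : ℝ) ≤ ((5 ^ (k * n₁) * 5 ^ (k * n₂)) * (5 ^ (k * n₁) * 5 ^ (k * n₂)) : ℕ) :=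
          Nat.cast_le.2 h1
      _ = _ := by
        rw [← pow_add, ← mul_pow, ← mul_add]
        norm_num
  calc _ ≤ P.real (⋃ q ∈ N, (bad (μ q.1.1 q.1.2 + μ q.2.1 q.2.2) ∪
        bad (μ q.1.1 q.1.2 - μ q.2.1 q.2.2))) := measureReal_mono hcover (measure_ne_top _ _)
    _ ≤ ∑ q ∈ N, P.real (bad (μ q.1.1 q.1.2 + μ q.2.1 q.2.2) ∪
        bad (μ q.1.1 q.1.2 - μ q.2.1 q.2.2)) := measureReal_biUnion_finset_le _ _
    _ ≤ ∑ _q ∈ N, 4 * ε := by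
        refine Finset.sum_le_sum fun q hq => ?_
        simp only [N, Finset.mem_product] at hq
        obtain ⟨⟨h1, h2⟩, h3, h4⟩ := hq
        have hY := hnorm _ h1 _ h2
        have hZ := hnorm _ h3 _ h4
        have hadd := hbad (μ q.1.1 q.1.2 + μ q.2.1 q.2.2) (by
          rw [map_add]; linarith [norm_add_le (vecEuclidean n₁ n₂ (μ q.1.1 q.1.2))
            (vecEuclidean n₁ n₂ (μ q.2.1 q.2.2))])
        have hsub := hbad (μ q.1.1 q.1.2 - μ q.2.1 q.2.2) (by
          rw [map_sub]; linarith [norm_sub_le (vecEuclidean n₁ n₂ (μ q.1.1 q.1.2))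
            (vecEuclidean n₁ n₂ (μ q.2.1 q.2.2))])
        linarith [measureReal_union_le (μ := P) (bad (μ q.1.1 q.1.2 + μ q.2.1 q.2.2))
          (bad (μ q.1.1 q.1.2 - μ q.2.1 q.2.2))]
    _ = N.card * (4 * ε) := by rw [Finset.sum_const, nsmul_eq_mul]
    _ ≤ _ := by gcongr

end RandomMap

/-! ### Choice of the constants. -/

theorem matrixRIP_zero {m n₁ n₂ : ℕ} (δ : ℝ)
    (T : Matrix (Fin n₁) (Fin n₂) ℝ →ₗ[ℝ] EuclideanSpace ℝ (Fin m)) : MatrixRIP 0 δ T := by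
  intro X hX
  have hX0 : X = 0 := by
    obtain ⟨U, W, rfl, -⟩ := exists_eq_factorMul_of_rank_le hX
    rw [Subsingleton.elim W 0, map_zero]
  rw [frobenius_norm_eq_norm_vecEuclidean, hX0]
  simp

theorem lemma2p5 (K : ℝ) (hK : 0 < K) :
    ∃ C₁ : ℝ, 0 < C₁ ∧ ∃ c : ℝ, 0 < c ∧
      ∀ (Ω : Type*) [MeasurableSpace Ω] (P : Measure Ω) [IsProbabilityMeasure P]
        (m n₁ n₂ k ℓ : ℕ) (hℓm : ℓ ≤ m)
        (M : Ω → Matrix (Fin n₁) (Fin n₂) ℝ →ₗ[ℝ] EuclideanSpace ℝ (Fin m))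
        (V : Matrix (Fin m) (Fin m) ℝ) (δ : ℝ),
        IsSubGaussianMap M K P →
        V ∈ Matrix.unitaryGroup (Fin m) ℝ →
        0 < δ → δ ≤ 1 →
        C₁ * ((k : ℝ) * ((n₁ : ℝ) + (n₂ : ℝ) + 1) / δ ^ 2) ≤ (ℓ : ℝ) →
        1 - 2 * Real.exp (-((c * δ ^ 2) * (ℓ : ℝ))) <
          P.real {ω | MatrixRIP k δ ((1 / Real.sqrt (ℓ : ℝ)) •
            (firstCoords hℓm ∘ₗ Matrix.toEuclideanLin V.conjTranspose ∘ₗ M ω))} := by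
  set κ : ℝ := 1 / (64 * (6144 * (48 * K + 4) ^ 2)) with hκ
  have hκ0 : 0 < κ := by positivity
  -- Half of the exponent `κ δ² ℓ` is kept as `C₂ ℓ`; the other half is at least `4k(n₁+n₂+1)` and
  -- pays for the union bound.
  refine ⟨8 / κ, by positivity, κ / 2, by positivity, ?_⟩
  intro Ω _ P _ m n₁ n₂ k ℓ hℓm M V δ hM hV hδ hδ1 hℓ
  -- For `k = 0` the lower bound on `ℓ` is vacuous and even `ℓ = 0` is possible, but the property
  -- holds surely.
  rcases Nat.eq_zero_or_pos k with rfl | hk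
  · simp only [matrixRIP_zero, Set.ofPred_true, probReal_univ]
    linarith [Real.exp_pos (-(κ / 2 * δ ^ 2 * (ℓ : ℝ)))]
  have hk1 : (1 : ℝ) ≤ k := Nat.one_le_cast.2 hk
  have hbig : 8 * ((k : ℝ) * (n₁ + n₂ + 1)) ≤ κ * δ ^ 2 * ℓ := by
    have h1 : 8 / κ * ((k : ℝ) * (n₁ + n₂ + 1) / δ ^ 2) =
        8 * ((k : ℝ) * (n₁ + n₂ + 1)) / (κ * δ ^ 2) := by field_simp
    rw [h1, div_le_iff₀ (by positivity)] at hℓ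
    linarith
  have hℓ0 : 0 < ℓ := by
    rcases Nat.eq_zero_or_pos ℓ with rfl | h
    · have : (0 : ℝ) < 8 * ((k : ℝ) * (n₁ + n₂ + 1)) := by positivity
      simp only [Nat.cast_zero, mul_zero] at hbig
      linarith
    · exact h
  have hbad := hM.measureReal_not_matrixRIP_le hK hℓm hℓ0 hV k hδ hδ1
  set good : Set Ω := {ω | MatrixRIP k δ (subsampled hℓm V (M ω))} with hgood
  -- Subadditivity suffices here, so measurability of the good event is not needed.
  have hunion : 1 ≤ P.real good + P.real goodᶜ := by
    have := measureReal_union_le (μ := P) good goodᶜ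
    rwa [Set.union_compl_self, probReal_univ] at this
  have hexp : -((δ / 8) ^ 2 / (6144 * (48 * K + 4) ^ 2) * ℓ) = -(κ * δ ^ 2 * ℓ) := by
    rw [hκ]; field_simp; norm_num
  rw [hexp] at hbad
  -- The spare factor 2 reduces the prefactor 4 to 2; it is paid for by the `+ 1` in `n₁ + n₂ + 1`,
  -- as `k ≥ 1`.
  have he : (25 : ℝ) * 2 < Real.exp 4 := by
    have h1 : Real.exp 4 = Real.exp 1 ^ 4 := by rw [← Real.exp_nat_mul]; norm_num
    rw [h1]
    calc (25 : ℝ) * 2 < 2.7 ^ 4 := by norm_num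
      _ ≤ Real.exp 1 ^ 4 := by gcongr; linarith [Real.exp_one_gt_d9]
  have hpow : (25 : ℝ) ^ (k * (n₁ + n₂)) * 2 < Real.exp (κ / 2 * δ ^ 2 * ℓ) := by
    calc (25 : ℝ) ^ (k * (n₁ + n₂)) * 2 ≤ Real.exp 4 ^ (k * (n₁ + n₂)) * 2 := by
          gcongr; linarith
      _ < Real.exp 4 ^ (k * (n₁ + n₂)) * Real.exp 4 := by
          gcongr; linarith
      _ = Real.exp (4 * (k * (n₁ + n₂) + 1)) := by
          rw [← pow_succ, ← Real.exp_nat_mul]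
          congr 1; push_cast; ring
      _ ≤ _ := by
          refine Real.exp_le_exp.2 ?_
          linarith
  have hfinal : 25 ^ (k * (n₁ + n₂)) * (4 * Real.exp (-(κ * δ ^ 2 * ℓ))) <
      2 * Real.exp (-(κ / 2 * δ ^ 2 * ℓ)) := by
    have h1 : Real.exp (-(κ / 2 * δ ^ 2 * ℓ)) =
        Real.exp (κ / 2 * δ ^ 2 * ℓ) * Real.exp (-(κ * δ ^ 2 * ℓ)) := by
      rw [← Real.exp_add]; congr 1; ring
    rw [h1]
    nlinarith [mul_lt_mul_of_pos_right hpow (Real.exp_pos (-(κ * δ ^ 2 * ℓ)))]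
  change _ < P.real good
  have hcompl : goodᶜ = {ω | ¬ MatrixRIP k δ (subsampled hℓm V (M ω))} := rfl
  rw [hcompl] at hunion
  linarith
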